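/- **Theorem 1.3 (Multiple deletion theorem, MDT).** Let $\mathbb K$ be an arbitrary field, $V=\mathbb K^\ell$ and $S=\mathbb K[x_1,\ldots,x_\ell]$. A hyperplane arrangement in $V$ is a finite set $\mathcal A$ of linear hyperplanes of $V$. For $H\in\mathcal A$ fix a linear form $\alpha_H$ with kernel $H$, and put $\mathcal A^H=\{H\cap L\mid L\in\mathcal A\setminus\{H\}\}$. The logarithmic derivation module is $$D(\mathcal A)=\{\theta\in\mathrm{Der}_{\mathbb K}(S)\mid \theta(\alpha_H)\in S\alpha_H\text{ for all }H\in\mathcal A\}.$$ A derivation $\theta$ is homogeneous of degree $d$ if $\theta(\alpha)$ is zero or a homogeneous polynomial of degree $d$ for every linear form $\alpha$. The arrangement $\mathcal A$ is free with exponents $(d_1,\ldots,d_\ell)$ if the $S$-module $D(\mathcal A)$ has a basis $\theta_1,\ldots,\theta_\ell$ with $\theta_i$ homogeneous of degree $d_i$. Let $\theta_E=\sum_i x_i\,\partial_{x_i}$ be the Euler derivation. Assume that $\mathcal A$ is free with exponents $(1,d_2,\ldots,d_\ell)$, where $1<d_2\le d_3\le\cdots\le d_\ell$. Let $2\le q\le\ell$,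 let $H_2,\ldots,H_q\in\mathcal A$, put $\alpha_j=\alpha_{H_j}$ and $\mathcal A'=\mathcal A\setminus\{H_2,\ldots,H_q\}$, and assume that 1. $|\mathcal A|-|\mathcal A^{H_j}|=d_j$ for $j=2,\ldots,q$; 2. $X=\bigcap_{j=2}^q H_j$ has codimension $q-1$ in $V$; 3. $X$ is contained in no hyperplane $K\in\mathcal A'$. Then $\mathcal A'$ is free with exponents $(1,d_2-1,\ldots,d_q-1,d_{q+1},\ldots,d_\ell)$. Moreover, $D(\mathcal A)$ has an $S$-basis of the form $$\theta_E,\ \alpha_2\eta_2,\ldots,\alpha_q\eta_q,\ \theta_{q+1},\ldots,\theta_\ell,$$ where $\eta_i\in\mathrm{Der}_{\mathbb K}(S)$ is homogeneous of degree $d_i-1$ for $2\le i\le q$ and $\theta_j$ is homogeneous of degree $d_j$ for $q<j\le\ell$. -/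

import Mathlib

open MvPolynomial

/-- The codimension of a linear subspace of `K^ℓ`. -/
noncomputable def codim {K : Type*} [Field K] {ℓ : ℕ} (X : Submodule K (Fin ℓ → K)) : ℕ :=
  Module.finrank K ((Fin ℓ → K) ⧸ X)

/-- A (central) hyperplane arrangement in `K^ℓ`: a finite set of linear hyperplanes. -/
structure HyperplaneArrangement (K : Type*) [Field K] (ℓ : ℕ) where
  hyperplanes : Finset (Submodule K (Fin ℓ → K))
  codim_eq_one : ∀ H ∈ hyperplanes, codim H = 1

/-- A linear form on `K^ℓ`, as an element of the coordinate ring `S = K[x_1, …, x_ℓ]`. -/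
noncomputable def linearFormPoly {K : Type*} [Field K] {ℓ : ℕ}
    (α : Module.Dual K (Fin ℓ → K)) : MvPolynomial (Fin ℓ) K :=
  ∑ i, C (α (Pi.single i 1)) * X i

/-- The module `Der S` of `K`-linear derivations of `S = K[x_1, …, x_ℓ]`. -/
abbrev PolyDer (K : Type*) [Field K] (ℓ : ℕ) : Type _ :=
  Derivation K (MvPolynomial (Fin ℓ) K) (MvPolynomial (Fin ℓ) K)

/-- The Euler derivation `∑ x_i ∂_{x_i}`. -/
noncomputable def eulerDer (K : Type*) [Field K] (ℓ : ℕ) : PolyDer K ℓ :=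
  mkDerivation K (fun i => (X i : MvPolynomial (Fin ℓ) K))

/-- `θ` is homogeneous of degree `n`: `θ(α)` is homogeneous of degree `n` (or zero)
for every linear form `α`. -/
def PolyDer.IsHomogeneousOfDegree {K : Type*} [Field K] {ℓ : ℕ} (θ : PolyDer K ℓ) (n : ℕ) :
    Prop :=
  ∀ α : Module.Dual K (Fin ℓ → K), (θ (linearFormPoly α)).IsHomogeneous n

namespace HyperplaneArrangement

/-- The logarithmic derivation module `D(𝒜)`. A form with kernel `H` is unique up to a nonzero
scalar, so it makes no difference whether one such form or all of them are tested
(see `mem_logDer_iff`). -/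
def logDer {K : Type*} [Field K] {ℓ : ℕ} (A : HyperplaneArrangement K ℓ) :
    Submodule (MvPolynomial (Fin ℓ) K) (PolyDer K ℓ) where
  carrier := {θ | ∀ H ∈ A.hyperplanes, ∀ α : Module.Dual K (Fin ℓ → K),
    LinearMap.ker α = H → θ (linearFormPoly α) ∈ Ideal.span {linearFormPoly α}}
  add_mem' := fun ha hb H hH α hα => Ideal.add_mem _ (ha H hH α hα) (hb H hH α hα)
  zero_mem' := fun _ _ _ _ => Ideal.zero_mem _
  smul_mem' := fun c _ h H hH α hα => Ideal.mul_mem_left _ c (h H hH α hα)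

/-- Membership in `D(𝒜)` can be tested on any fixed choice of defining forms. -/
theorem mem_logDer_iff {K : Type*} [Field K] {ℓ : ℕ} (A : HyperplaneArrangement K ℓ)
    (form : Submodule K (Fin ℓ → K) → Module.Dual K (Fin ℓ → K))
    (hform : ∀ H ∈ A.hyperplanes, LinearMap.ker (form H) = H) (θ : PolyDer K ℓ) :
    θ ∈ A.logDer ↔ ∀ H ∈ A.hyperplanes,
      θ (linearFormPoly (form H)) ∈ Ideal.span {linearFormPoly (form H)} := by
  refine ⟨fun h H hH => h H hH _ (hform H hH), fun h H hH α hα => ?_⟩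
  have aux : ∀ β γ : Module.Dual K (Fin ℓ → K), LinearMap.ker β = LinearMap.ker γ →
      ∃ c : K, c • β = γ := by
    intro β γ h
    have := mem_span_of_iInf_ker_le_ker (L := fun _ : Unit => β) (K := γ) (by simp [h])
    simpa [Submodule.mem_span_singleton] using this
  obtain ⟨c, hc⟩ := aux α (form H) (by rw [hα, hform H hH])
  obtain ⟨e, he⟩ := aux (form H) α (by rw [hα, hform H hH])
  have key : ∀ (a : K) (β : Module.Dual K (Fin ℓ → K)),
      linearFormPoly (a • β) = C a * linearFormPoly β := by
    intro a β
    simp [linearFormPoly, Finset.mul_sum, mul_assoc]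
  have h1 := h H hH
  rw [Ideal.mem_span_singleton] at h1 ⊢
  have h2 : linearFormPoly α ∣ linearFormPoly (form H) := ⟨C c, by rw [← hc, key, mul_comm]⟩
  have h3 : θ (linearFormPoly α) = C e * θ (linearFormPoly (form H)) := by
    rw [← he, key, Derivation.leibniz]
    simp [← algebraMap_eq]
  rw [h3]
  exact Dvd.dvd.mul_left (h2.trans h1) _

/-- `𝒜` is free with exponents `(d_1, …, d_ℓ)`: the `S`-module `D(𝒜)` has a basis
`θ_1, …, θ_ℓ` with `θ_i` homogeneous of degree `d_i`. -/
def IsFreeWithExponents {K : Type*} [Field K] {ℓ : ℕ} (A : HyperplaneArrangement K ℓ)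
    (d : Fin ℓ → ℕ) : Prop :=
  ∃ b : Module.Basis (Fin ℓ) (MvPolynomial (Fin ℓ) K) A.logDer,
    ∀ i, (b i : PolyDer K ℓ).IsHomogeneousOfDegree (d i)

open Classical in
/-- The restriction `𝒜^H = {H ∩ L | L ∈ 𝒜 ∖ {H}}`, as a set of subspaces of `H`. -/
noncomputable def restriction {K : Type*} [Field K] {ℓ : ℕ} (A : HyperplaneArrangement K ℓ)
    (H : Submodule K (Fin ℓ → K)) : Finset (Submodule K (Fin ℓ → K)) :=
  (A.hyperplanes.erase H).image (fun L => H ⊓ L)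

open Classical in
/-- The arrangement `𝒜 ∖ B`. -/
noncomputable def deletion {K : Type*} [Field K] {ℓ : ℕ} (A : HyperplaneArrangement K ℓ)
    (B : Set (Submodule K (Fin ℓ → K))) : HyperplaneArrangement K ℓ where
  hyperplanes := A.hyperplanes.filter (fun H => H ∉ B)
  codim_eq_one := fun H hH => A.codim_eq_one H (Finset.mem_filter.1 hH).1

end HyperplaneArrangement

/-- The indices `2, …, q` among `1, …, ℓ`; since `Fin ℓ` counts from `0`, these are the
`i : Fin ℓ` with `1 ≤ i < q`. -/
def deletedIndices (ℓ q : ℕ) : Finset (Fin ℓ) :=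
  Finset.univ.filter (fun i => 1 ≤ i.val ∧ i.val < q)

/-! Each deleted `H_j` gets a derivation `η_j` of degree `d_j - 1` that is logarithmic along all
other hyperplanes but not along `H_j`. The derivations `θ_E` and `α_j η_j` are exchanged into the
given basis of `D(𝒜)`. Cancelling the row factors `α_j` then leaves members of `D(𝒜')` with nonzero
determinant and degrees summing to `|𝒜'|`, a basis by Saito's criterion.

Construction of `η_j` (`exists_derivation_of_basis`): for `v` with `α_j(v) = 1`, Cramer's rule gives
`det(b) ∂_v = ∑ D_i b_i`. The left side restricts to zero on `H_j`, and each restricted `D_i` is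
divisible by the product of one form per element of `𝒜^{H_j}`. Division yields a relation of degree
`|𝒜| - |𝒜^{H_j}| = d_j`, that is, `∑ g_i b_i = α_j η_j`. If `η_j` were in `D(𝒜)`, all `D_i` would be
divisible by `α_j`, so `(det(b)/α_j) ∂_v` would lie in `D(𝒜)`, which is false.

Independence: Terao's polynomial `B` divides `η_j(α_j)` modulo `α_j` and has the same degree, so the
two agree up to a nonzero constant (`map_apply_ne_zero`). No factor of `B` restricts to zero on `X`:
by condition 3 it would define some `H_k`, and the second hyperplane through `H_j ∩ H_k` would be a
third `H_i`, against condition 2. So `η_j(α_j)` is nonzero on `X`. In a relation `α_k η_k = f_0 θ_E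
+ ∑ f_i α_i η_i`, restriction to `X ≠ 0` kills `f_0`; evaluation at `α_k` and division by `α_k` then
make `η_k(α_k)` zero on `X`, a contradiction (`smul_ne_sum_of_linSubst`). -/

/-! ### Linear forms, substitution, and divisibility as vanishing on a hyperplane -/

section LinearForms

variable {K : Type*} [Field K] {ℓ : ℕ}

theorem linearFormPoly_add (α β : Module.Dual K (Fin ℓ → K)) :
    linearFormPoly (α + β) = linearFormPoly α + linearFormPoly β := by
  simp [linearFormPoly, add_mul, Finset.sum_add_distrib]

theorem linearFormPoly_smul (a : K) (β : Module.Dual K (Fin ℓ → K)) :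
    linearFormPoly (a • β) = C a * linearFormPoly β := by
  simp [linearFormPoly, Finset.mul_sum, mul_assoc]

theorem linearFormPoly_zero : linearFormPoly (0 : Module.Dual K (Fin ℓ → K)) = 0 := by
  simp [linearFormPoly]

theorem linearFormPoly_sub (α β : Module.Dual K (Fin ℓ → K)) :
    linearFormPoly (α - β) = linearFormPoly α - linearFormPoly β := by
  simp [linearFormPoly, sub_mul, Finset.sum_sub_distrib]

theorem linearFormPoly_proj (k : Fin ℓ) :
    linearFormPoly (LinearMap.proj k : Module.Dual K (Fin ℓ → K)) = X k := by
  simp only [linearFormPoly, LinearMap.proj_apply]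
  rw [Finset.sum_eq_single k] <;> simp +contextual [eq_comm]

theorem linearFormPoly_sum {ι : Type*} (s : Finset ι) (f : ι → Module.Dual K (Fin ℓ → K)) :
    linearFormPoly (∑ i ∈ s, f i) = ∑ i ∈ s, linearFormPoly (f i) := by
  classical
  induction s using Finset.induction_on with
  | empty => simp [linearFormPoly_zero]
  | insert a s ha ih => rw [Finset.sum_insert ha, Finset.sum_insert ha, linearFormPoly_add, ih]

theorem eval_linearFormPoly (α : Module.Dual K (Fin ℓ → K)) (v : Fin ℓ → K) :
    eval v (linearFormPoly α) = α v := by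
  simp only [linearFormPoly, map_sum, map_mul, eval_C, eval_X]
  conv_rhs => rw [LinearMap.pi_apply_eq_sum_univ α v]
  simp only [smul_eq_mul, mul_comm]
  refine Finset.sum_congr rfl fun i _ => ?_
  congr 2
  ext j
  simp [Pi.single_apply, eq_comm]

theorem linearFormPoly_eq_zero_iff {α : Module.Dual K (Fin ℓ → K)} :
    linearFormPoly α = 0 ↔ α = 0 := by
  refine ⟨fun h => LinearMap.ext fun v => ?_, fun h => by rw [h, linearFormPoly_zero]⟩
  rw [← eval_linearFormPoly, h]
  simp

theorem linearFormPoly_isHomogeneous (α : Module.Dual K (Fin ℓ → K)) :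
    (linearFormPoly α).IsHomogeneous 1 :=
  IsHomogeneous.sum _ _ _ fun i _ => isHomogeneous_C_mul_X _ i

theorem derivation_linearFormPoly (θ : PolyDer K ℓ) (β : Module.Dual K (Fin ℓ → K)) :
    θ (linearFormPoly β) = ∑ k, C (β (Pi.single k 1)) * θ (X k) := by
  rw [linearFormPoly, map_sum]
  refine Finset.sum_congr rfl fun k _ => ?_
  rw [Derivation.leibniz]
  simp

theorem PolyDer.isHomogeneousOfDegree_iff {θ : PolyDer K ℓ} {n : ℕ} :
    θ.IsHomogeneousOfDegree n ↔ ∀ k, (θ (X k)).IsHomogeneous n := by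
  refine ⟨fun h k => linearFormPoly_proj (K := K) k ▸ h _, fun h α => ?_⟩
  rw [derivation_linearFormPoly]
  exact IsHomogeneous.sum _ _ _ fun k _ => (h k).C_mul _

/-- The substitution of linear forms dual to an endomorphism of `K^ℓ`. -/
noncomputable def linSubst (P : (Fin ℓ → K) →ₗ[K] (Fin ℓ → K)) :
    MvPolynomial (Fin ℓ) K →ₐ[K] MvPolynomial (Fin ℓ) K :=
  aeval fun k => linearFormPoly (LinearMap.proj k ∘ₗ P)

theorem linSubst_linearFormPoly (P : (Fin ℓ → K) →ₗ[K] (Fin ℓ → K))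
    (β : Module.Dual K (Fin ℓ → K)) :
    linSubst P (linearFormPoly β) = linearFormPoly (β ∘ₗ P) := by
  have h : β ∘ₗ P = ∑ k, β (Pi.single k 1) • (LinearMap.proj k ∘ₗ P) := by
    refine LinearMap.ext fun v => ?_
    simp only [LinearMap.comp_apply, LinearMap.sum_apply, LinearMap.smul_apply, smul_eq_mul,
      LinearMap.proj_apply]
    conv_lhs => rw [LinearMap.pi_apply_eq_sum_univ β (P v)]
    simp only [smul_eq_mul, mul_comm]
    refine Finset.sum_congr rfl fun i _ => ?_
    congr 2
    ext j
    simp [Pi.single_apply, eq_comm]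
  rw [h, linearFormPoly_sum]
  simp only [linearFormPoly, map_sum, map_mul]
  refine Finset.sum_congr rfl fun k _ => ?_
  rw [← linearFormPoly, linearFormPoly_smul, linSubst]
  simp [linearFormPoly]

theorem linSubst_isHomogeneous (P : (Fin ℓ → K) →ₗ[K] (Fin ℓ → K))
    {f : MvPolynomial (Fin ℓ) K} {n : ℕ} (hf : f.IsHomogeneous n) :
    (linSubst P f).IsHomogeneous n := by
  have := hf.aeval (fun k => linearFormPoly (LinearMap.proj k ∘ₗ P))
    fun k => linearFormPoly_isHomogeneous _
  rwa [one_mul] at this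

/-- The projection of `K^ℓ` along `v` to the kernel of `α`, when `α v = 1`. -/
def projAlong (α : Module.Dual K (Fin ℓ → K)) (v : Fin ℓ → K) :
    (Fin ℓ → K) →ₗ[K] (Fin ℓ → K) :=
  LinearMap.id - α.smulRight v

theorem comp_projAlong (α β : Module.Dual K (Fin ℓ → K)) (v : Fin ℓ → K) :
    β ∘ₗ projAlong α v = β - β v • α := by
  refine LinearMap.ext fun w => ?_
  simp [projAlong, mul_comm]

theorem linearFormPoly_dvd_sub_linSubst (α : Module.Dual K (Fin ℓ → K)) (v : Fin ℓ → K)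
    (f : MvPolynomial (Fin ℓ) K) :
    linearFormPoly α ∣ f - linSubst (projAlong α v) f := by
  induction f using MvPolynomial.induction_on with
  | C a => simp [linSubst]
  | add p q hp hq =>
    rw [map_add, add_sub_add_comm]
    exact dvd_add hp hq
  | mul_X p k hp =>
    have h : linearFormPoly α ∣ X k - linSubst (projAlong α v) (X k) := by
      rw [← linearFormPoly_proj, linSubst_linearFormPoly, comp_projAlong, ← linearFormPoly_sub,
        sub_sub_cancel, linearFormPoly_smul]
      exact dvd_mul_left _ _
    rw [map_mul, ← sub_add_sub_cancel _ (linSubst (projAlong α v) p * X k), ← sub_mul, ← mul_sub]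
    exact dvd_add (hp.mul_right _) (h.mul_left _)

/-- Substituting the projection along `v` models restriction to the hyperplane while staying in the
same polynomial ring. It changes `f` only by multiples of `α`. -/
theorem linearFormPoly_dvd_iff {α : Module.Dual K (Fin ℓ → K)} {v : Fin ℓ → K} (hv : α v = 1)
    {f : MvPolynomial (Fin ℓ) K} :
    linearFormPoly α ∣ f ↔ linSubst (projAlong α v) f = 0 := by
  constructor
  · rintro ⟨g, rfl⟩
    rw [map_mul, linSubst_linearFormPoly, comp_projAlong, hv, one_smul, sub_self,
      linearFormPoly_zero, zero_mul]
  · intro h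
    have := linearFormPoly_dvd_sub_linSubst α v f
    rwa [h, sub_zero] at this

theorem exists_dual_apply_eq_one {α : Module.Dual K (Fin ℓ → K)} (hα : α ≠ 0) :
    ∃ v, α v = 1 := by
  obtain ⟨w, hw⟩ := DFunLike.ne_iff.1 hα
  exact ⟨(α w)⁻¹ • w, by simpa using inv_mul_cancel₀ hw⟩

theorem linearFormPoly_prime {α : Module.Dual K (Fin ℓ → K)} (hα : α ≠ 0) :
    Prime (linearFormPoly α) := by
  obtain ⟨v, hv⟩ := exists_dual_apply_eq_one hα
  refine ⟨mt linearFormPoly_eq_zero_iff.1 hα, fun h => ?_, fun f g h => ?_⟩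
  · have := (linearFormPoly_dvd_iff (f := 1) hv).1 h.dvd
    simp at this
  · rw [linearFormPoly_dvd_iff hv, map_mul, mul_eq_zero] at h
    simpa only [linearFormPoly_dvd_iff hv] using h

theorem linearFormPoly_dvd_linearFormPoly {α β : Module.Dual K (Fin ℓ → K)} (hα : α ≠ 0)
    (h : linearFormPoly α ∣ linearFormPoly β) : LinearMap.ker α ≤ LinearMap.ker β := by
  obtain ⟨v, hv⟩ := exists_dual_apply_eq_one hα
  rw [linearFormPoly_dvd_iff hv, linSubst_linearFormPoly, linearFormPoly_eq_zero_iff,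
    comp_projAlong, sub_eq_zero] at h
  intro w hw
  rw [LinearMap.mem_ker] at hw ⊢
  rw [h, LinearMap.smul_apply, hw, smul_zero]

theorem linearFormPoly_isRelPrime {α β : Module.Dual K (Fin ℓ → K)} (hα : α ≠ 0)
    (h : ¬ LinearMap.ker α ≤ LinearMap.ker β) :
    IsRelPrime (linearFormPoly α) (linearFormPoly β) :=
  (linearFormPoly_prime hα).irreducible.isRelPrime_iff_not_dvd.2
    fun hd => h (linearFormPoly_dvd_linearFormPoly hα hd)

theorem codim_ker_eq_one_iff {α : Module.Dual K (Fin ℓ → K)} :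
    codim (LinearMap.ker α) = 1 ↔ α ≠ 0 := by
  have h := α.quotKerEquivRange.finrank_eq
  constructor
  · rintro h1 rfl
    rw [codim, h, LinearMap.range_zero, finrank_bot] at h1
    exact zero_ne_one h1
  · intro hα
    rw [codim, h, LinearMap.range_eq_top.2 (LinearMap.surjective hα), finrank_top,
      Module.finrank_self]

theorem exists_ker_eq_of_codim_eq_one {H : Submodule K (Fin ℓ → K)} (hH : codim H = 1) :
    ∃ α : Module.Dual K (Fin ℓ → K), LinearMap.ker α = H := by
  obtain ⟨e⟩ := FiniteDimensional.nonempty_linearEquiv_of_finrank_eq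
    (R := K) (hH.trans (Module.finrank_self K).symm)
  exact ⟨e.toLinearMap ∘ₗ H.mkQ, by rw [LinearEquiv.ker_comp, Submodule.ker_mkQ]⟩

theorem eq_of_le_of_codim_eq {H L : Submodule K (Fin ℓ → K)} (h : H ≤ L)
    (hc : codim H = codim L) : H = L := by
  refine Submodule.eq_of_le_of_finrank_eq h ?_
  have h1 := H.finrank_quotient_add_finrank
  have h2 := L.finrank_quotient_add_finrank
  rw [codim, codim] at hc
  omega

end LinearForms

/-! ### Homogeneous factors and determinants -/

section Homogeneous

variable {σ R : Type*} [CommRing R]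

/-- Only the component of `g` of degree `n - m` contributes to the degree `n` part of `p * g`. The
second conclusion covers truncated subtraction. -/
theorem MvPolynomial.IsHomogeneous.of_mul_left [IsDomain R] {p g : MvPolynomial σ R} {m n : ℕ}
    (hp : p.IsHomogeneous m) (hp0 : p ≠ 0) (h : (p * g).IsHomogeneous n) :
    g.IsHomogeneous (n - m) ∧ (n < m → g = 0) := by
  have key : p * g = ∑ i ∈ Finset.range (g.totalDegree + 1),
      if n = m + i then p * homogeneousComponent i g else 0 := by
    conv_lhs => rw [← homogeneousComponent_eq_self h]
    conv_lhs => rw [← sum_homogeneousComponent g]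
    rw [Finset.mul_sum, map_sum]
    refine Finset.sum_congr rfl fun i _ => ?_
    rw [homogeneousComponent_of_mem (m := n) (n := m + i)]
    exact hp.mul (homogeneousComponent_isHomogeneous i g)
  have hlt : n < m → g = 0 := fun hnm => by
    rw [Finset.sum_eq_zero fun i _ => if_neg (by omega), mul_eq_zero] at key
    exact key.resolve_left hp0
  refine ⟨?_, hlt⟩
  rcases lt_or_ge n m with hnm | hnm
  · rw [hlt hnm]
    exact isHomogeneous_zero _ _ _
  · have h2 : p * g = p * homogeneousComponent (n - m) g := by
      rw [key]
      by_cases hd : n - m < g.totalDegree + 1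
      · rw [Finset.sum_eq_single_of_mem (n - m) (Finset.mem_range.2 hd)
          fun i _ hi => if_neg (by omega), if_pos (by omega)]
      · rw [homogeneousComponent_eq_zero _ _ (by omega), mul_zero]
        refine Finset.sum_eq_zero fun i hi => if_neg ?_
        rw [Finset.mem_range] at hi
        omega
    rw [mul_left_cancel₀ hp0 h2]
    exact homogeneousComponent_isHomogeneous _ _

theorem MvPolynomial.IsHomogeneous.det {n : Type*} [Fintype n] [DecidableEq n]
    {N : Matrix n n (MvPolynomial σ R)} {d : n → ℕ} (h : ∀ i k, (N i k).IsHomogeneous (d i)) :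
    N.det.IsHomogeneous (∑ i, d i) := by
  rw [← Matrix.det_transpose, Matrix.det_apply]
  refine IsHomogeneous.sum _ _ _ fun τ _ => ?_
  have : (∏ i, N.transpose (τ i) i).IsHomogeneous (∑ i, d i) :=
    IsHomogeneous.prod _ _ _ fun i _ => h i _
  rcases Int.units_eq_one_or (Equiv.Perm.sign τ) with hs | hs <;> rw [hs]
  · rwa [one_smul]
  · rw [Units.neg_smul, one_smul]
    exact this.neg

end Homogeneous

/-! ### Coefficient determinants of families of derivations -/

theorem Matrix.dvd_det_mul_of_dvd_mulVec {n R : Type*} [Fintype n] [DecidableEq n] [CommRing R]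
    (N : Matrix n n R) (c : n → R) {p : R} (h : ∀ i, p ∣ (N.mulVec c) i) (k : n) :
    p ∣ N.det * c k := by
  have h1 : N.adjugate.mulVec (N.mulVec c) = N.det • c := by
    rw [Matrix.mulVec_mulVec, Matrix.adjugate_mul, Matrix.smul_mulVec, Matrix.one_mulVec]
  have h2 := congrFun h1 k
  rw [Pi.smul_apply, smul_eq_mul] at h2
  rw [← h2]
  exact Finset.dvd_sum fun i _ => (h i).mul_left _

section CoeffDet

variable {K : Type*} [Field K] {ℓ : ℕ}

/-- The coefficient matrix of a family of derivations with respect to the partial derivatives. -/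
noncomputable def coeffMatrix (b : Fin ℓ → PolyDer K ℓ) :
    Matrix (Fin ℓ) (Fin ℓ) (MvPolynomial (Fin ℓ) K) :=
  Matrix.of fun i k => b i (X k)

/-- The determinant of the coefficient matrix of a family of derivations. -/
noncomputable def coeffDet (b : Fin ℓ → PolyDer K ℓ) : MvPolynomial (Fin ℓ) K :=
  (coeffMatrix b).det

theorem coeffMatrix_mulVec (b : Fin ℓ → PolyDer K ℓ) (β : Module.Dual K (Fin ℓ → K)) (i : Fin ℓ) :
    (coeffMatrix b).mulVec (fun k => C (β (Pi.single k 1))) i = b i (linearFormPoly β) := by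
  rw [derivation_linearFormPoly]
  simp [Matrix.mulVec, dotProduct, coeffMatrix, mul_comm]

theorem coeffMatrix_update (b : Fin ℓ → PolyDer K ℓ) (i : Fin ℓ) (θ : PolyDer K ℓ) :
    coeffMatrix (Function.update b i θ) = (coeffMatrix b).updateRow i fun k => θ (X k) := by
  ext j k : 2
  by_cases h : j = i
  · subst h; simp [coeffMatrix]
  · simp [coeffMatrix, h]

theorem coeffDet_isHomogeneous {b : Fin ℓ → PolyDer K ℓ} {d : Fin ℓ → ℕ}
    (h : ∀ i, (b i).IsHomogeneousOfDegree (d i)) : (coeffDet b).IsHomogeneous (∑ i, d i) :=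
  IsHomogeneous.det fun i k => PolyDer.isHomogeneousOfDegree_iff.1 (h i) k

theorem sum_smul_apply {ι : Type*} (s : Finset ι) (g : ι → MvPolynomial (Fin ℓ) K)
    (b : ι → PolyDer K ℓ) (f : MvPolynomial (Fin ℓ) K) :
    (∑ i ∈ s, g i • b i) f = ∑ i ∈ s, g i * b i f := by
  rw [← Derivation.coeFnAddMonoidHom_apply, map_sum, Finset.sum_apply]
  rfl

/-- Cramer's rule for the coordinates of `θ`, cleared of denominators so that no independence is
needed. -/
theorem coeffDet_smul_eq_sum (b : Fin ℓ → PolyDer K ℓ) (θ : PolyDer K ℓ) :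
    coeffDet b • θ = ∑ i, coeffDet (Function.update b i θ) • b i := by
  refine derivation_ext fun k => ?_
  have h := congrFun ((coeffMatrix b).transpose.mulVec_cramer fun k => θ (X k)) k
  rw [Matrix.det_transpose, Pi.smul_apply, smul_eq_mul] at h
  rw [Derivation.smul_apply, smul_eq_mul, coeffDet, ← h, sum_smul_apply]
  change ∑ i, (coeffMatrix b).transpose k i * _ = _
  refine Finset.sum_congr rfl fun i _ => ?_
  rw [Matrix.cramer_transpose_apply, coeffDet, coeffMatrix_update]
  simp [coeffMatrix, mul_comm]

theorem exists_coeff_ne_zero {β : Module.Dual K (Fin ℓ → K)} (hβ : β ≠ 0) :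
    ∃ k, β (Pi.single k 1) ≠ 0 := by
  by_contra! h
  refine hβ (linearFormPoly_eq_zero_iff.1 ?_)
  simp [linearFormPoly, h]

/-- The values at `β` combine the columns with the coefficients of `β`, one of which is a unit. The
homomorphism `f` makes this available after restriction to a hyperplane. -/
theorem linearFormPoly_dvd_det {R : Type*} [CommRing R] (f : MvPolynomial (Fin ℓ) K →+* R)
    {b : Fin ℓ → PolyDer K ℓ} {β : Module.Dual K (Fin ℓ → K)} (hβ : β ≠ 0) {p : R}
    (h : ∀ i, p ∣ f (b i (linearFormPoly β))) : p ∣ f (coeffDet b) := by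
  obtain ⟨k, hk⟩ := exists_coeff_ne_zero hβ
  have h1 := ((coeffMatrix b).map f).dvd_det_mul_of_dvd_mulVec
    (fun k => f (C (β (Pi.single k 1)))) (p := p) (fun i => by
      have := f.map_mulVec (coeffMatrix b) (fun k => C (β (Pi.single k 1))) i
      rw [coeffMatrix_mulVec] at this
      have h2 := h i
      rw [this] at h2
      exact h2) k
  have hu : IsUnit (f (C (β (Pi.single k 1)))) := ((Ne.isUnit hk).map C).map f
  rw [hu.dvd_mul_right, ← RingHom.mapMatrix_apply, ← RingHom.map_det] at h1
  exact h1

/-- The derivation with constant coefficient vector `v`. -/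
noncomputable def constDer (v : Fin ℓ → K) : PolyDer K ℓ :=
  mkDerivation K fun k => C (v k)

theorem constDer_linearFormPoly (v : Fin ℓ → K) (β : Module.Dual K (Fin ℓ → K)) :
    constDer v (linearFormPoly β) = C (β v) := by
  rw [derivation_linearFormPoly, ← eval_linearFormPoly β v]
  simp [constDer, linearFormPoly]

theorem constDer_isHomogeneousOfDegree (v : Fin ℓ → K) : (constDer v).IsHomogeneousOfDegree 0 :=
  fun β => by
    rw [constDer_linearFormPoly]
    exact isHomogeneous_C _ _

theorem eulerDer_linearFormPoly (β : Module.Dual K (Fin ℓ → K)) :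
    eulerDer K ℓ (linearFormPoly β) = linearFormPoly β := by
  rw [derivation_linearFormPoly]
  simp [eulerDer, linearFormPoly]

theorem eq_smul_of_forall_dvd {θ : PolyDer K ℓ} {p : MvPolynomial (Fin ℓ) K}
    (h : ∀ k, p ∣ θ (X k)) : ∃ η : PolyDer K ℓ, θ = p • η := by
  choose c hc using h
  refine ⟨mkDerivation K c, derivation_ext fun k => ?_⟩
  simp [hc]

theorem PolyDer.IsHomogeneousOfDegree.of_smul {η : PolyDer K ℓ} {α : Module.Dual K (Fin ℓ → K)}
    (hα : α ≠ 0) {n : ℕ} (h : PolyDer.IsHomogeneousOfDegree (linearFormPoly α • η) n) :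
    η.IsHomogeneousOfDegree (n - 1) := fun β =>
  ((linearFormPoly_isHomogeneous α).of_mul_left (mt linearFormPoly_eq_zero_iff.1 hα) (h β)).1

end CoeffDet

/-! ### Saito's criterion -/

section Saito

variable {K : Type*} [Field K] {ℓ : ℕ}

theorem coeffDet_dvd_of_eq_sum {b N : Fin ℓ → PolyDer K ℓ}
    (h : ∀ i, ∃ c : Fin ℓ → MvPolynomial (Fin ℓ) K, N i = ∑ j, c j • b j) :
    coeffDet b ∣ coeffDet N := by
  choose c hc using h
  have : coeffMatrix N = Matrix.of c * coeffMatrix b := by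
    ext i k : 2
    simp only [coeffMatrix, Matrix.of_apply, Matrix.mul_apply, hc i, sum_smul_apply]
  rw [coeffDet, coeffDet, this, Matrix.det_mul]
  exact dvd_mul_left _ _

theorem linearIndependent_of_coeffDet_ne_zero {b : Fin ℓ → PolyDer K ℓ} (hne : coeffDet b ≠ 0) :
    LinearIndependent (MvPolynomial (Fin ℓ) K) b := by
  refine Fintype.linearIndependent_iff.2 fun g hg => ?_
  have h : Matrix.vecMul g (coeffMatrix b) = 0 := by
    ext1 k
    have := congrArg (fun θ : PolyDer K ℓ => θ (X k)) hg
    simp only [sum_smul_apply] at this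
    exact this
  exact congrFun (Matrix.eq_zero_of_vecMul_eq_zero hne h)

theorem Matrix.det_one_add_vecMulVec {n R : Type*} [Fintype n] [DecidableEq n] [CommRing R]
    (u v : n → R) : (1 + Matrix.vecMulVec u v).det = 1 + v ⬝ᵥ u := by
  rw [Matrix.vecMulVec_eq Unit, Matrix.det_one_add_replicateCol_mul_replicateRow]

namespace HyperplaneArrangement

theorem exists_form (A : HyperplaneArrangement K ℓ) :
    ∃ form : Submodule K (Fin ℓ → K) → Module.Dual K (Fin ℓ → K),
      ∀ H ∈ A.hyperplanes, LinearMap.ker (form H) = H := by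
  classical
  choose f hf using fun H : A.hyperplanes =>
    exists_ker_eq_of_codim_eq_one (A.codim_eq_one H.1 H.2)
  exact ⟨fun H => if h : H ∈ A.hyperplanes then f ⟨H, h⟩ else 0, fun H hH => by
    simp only [dif_pos hH, hf]⟩

theorem exists_form_eq (A : HyperplaneArrangement K ℓ) {H : Submodule K (Fin ℓ → K)}
    {α : Module.Dual K (Fin ℓ → K)} (hα : LinearMap.ker α = H) :
    ∃ form : Submodule K (Fin ℓ → K) → Module.Dual K (Fin ℓ → K),
      (∀ H ∈ A.hyperplanes, LinearMap.ker (form H) = H) ∧ form H = α := by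
  classical
  obtain ⟨f, hf⟩ := A.exists_form
  refine ⟨Function.update f H α, fun L hL => ?_, Function.update_self ..⟩
  by_cases h : L = H
  · rw [h, Function.update_self, hα]
  · rw [Function.update_of_ne h, hf L hL]

/-- The defining polynomial of an arrangement, for a choice of defining forms. -/
noncomputable def formProd (A : HyperplaneArrangement K ℓ)
    (form : Submodule K (Fin ℓ → K) → Module.Dual K (Fin ℓ → K)) : MvPolynomial (Fin ℓ) K :=
  ∏ H ∈ A.hyperplanes, linearFormPoly (form H)

variable {A : HyperplaneArrangement K ℓ}

theorem not_le_of_ne {H L : Submodule K (Fin ℓ → K)} (hH : H ∈ A.hyperplanes)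
    (hL : L ∈ A.hyperplanes) (h : H ≠ L) : ¬ H ≤ L := fun hle =>
  h (eq_of_le_of_codim_eq hle ((A.codim_eq_one H hH).trans (A.codim_eq_one L hL).symm))

variable {form : Submodule K (Fin ℓ → K) → Module.Dual K (Fin ℓ → K)}

theorem form_ne_zero (hform : ∀ H ∈ A.hyperplanes, LinearMap.ker (form H) = H)
    {H : Submodule K (Fin ℓ → K)} (hH : H ∈ A.hyperplanes) : form H ≠ 0 := by
  rw [← codim_ker_eq_one_iff, hform H hH]
  exact A.codim_eq_one H hH

theorem form_isRelPrime (hform : ∀ H ∈ A.hyperplanes, LinearMap.ker (form H) = H)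
    {H L : Submodule K (Fin ℓ → K)} (hH : H ∈ A.hyperplanes) (hL : L ∈ A.hyperplanes)
    (h : H ≠ L) : IsRelPrime (linearFormPoly (form H)) (linearFormPoly (form L)) := by
  refine linearFormPoly_isRelPrime (form_ne_zero hform hH) ?_
  rw [hform H hH, hform L hL]
  exact not_le_of_ne hH hL h

theorem form_not_dvd (hform : ∀ H ∈ A.hyperplanes, LinearMap.ker (form H) = H)
    {H L : Submodule K (Fin ℓ → K)} (hH : H ∈ A.hyperplanes) (hL : L ∈ A.hyperplanes)
    (h : H ≠ L) : ¬ linearFormPoly (form H) ∣ linearFormPoly (form L) :=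
  (linearFormPoly_prime (form_ne_zero hform hH)).irreducible.isRelPrime_iff_not_dvd.1
    (form_isRelPrime hform hH hL h)

theorem formProd_isHomogeneous (A : HyperplaneArrangement K ℓ)
    (form : Submodule K (Fin ℓ → K) → Module.Dual K (Fin ℓ → K)) :
    (A.formProd form).IsHomogeneous A.hyperplanes.card := by
  have := IsHomogeneous.prod A.hyperplanes (fun H => linearFormPoly (form H)) (fun _ => 1)
    fun H _ => linearFormPoly_isHomogeneous (form H)
  rw [Finset.sum_const, smul_eq_mul, mul_one] at this
  exact this

theorem formProd_ne_zero (hform : ∀ H ∈ A.hyperplanes, LinearMap.ker (form H) = H) :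
    A.formProd form ≠ 0 :=
  Finset.prod_ne_zero_iff.2 fun _ hH => mt linearFormPoly_eq_zero_iff.1 (form_ne_zero hform hH)

theorem mem_logDer_iff_dvd (hform : ∀ H ∈ A.hyperplanes, LinearMap.ker (form H) = H)
    {θ : PolyDer K ℓ} : θ ∈ A.logDer ↔ ∀ H ∈ A.hyperplanes,
      linearFormPoly (form H) ∣ θ (linearFormPoly (form H)) := by
  simp only [A.mem_logDer_iff form hform, Ideal.mem_span_singleton]

theorem formProd_dvd_coeffDet (hform : ∀ H ∈ A.hyperplanes, LinearMap.ker (form H) = H)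
    {b : Fin ℓ → PolyDer K ℓ} (hb : ∀ i, b i ∈ A.logDer) : A.formProd form ∣ coeffDet b := by
  refine Finset.prod_dvd_of_isRelPrime
    (fun H hH L hL h => form_isRelPrime hform hH hL h) fun H hH => ?_
  exact linearFormPoly_dvd_det (RingHom.id _) (form_ne_zero hform hH)
    fun i => (mem_logDer_iff_dvd hform).1 (hb i) H hH

theorem exists_eq_sum_of_basis (b : Module.Basis (Fin ℓ) (MvPolynomial (Fin ℓ) K) A.logDer)
    {θ : PolyDer K ℓ} (hθ : θ ∈ A.logDer) :
    ∃ c : Fin ℓ → MvPolynomial (Fin ℓ) K, θ = ∑ j, c j • (b j : PolyDer K ℓ) := by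
  refine ⟨b.repr ⟨θ, hθ⟩, ?_⟩
  have := congrArg A.logDer.subtype (b.sum_repr ⟨θ, hθ⟩)
  rw [map_sum] at this
  exact this.symm

/-- With `Q` the defining polynomial, the derivations `Q ∂_i` lie in `D(𝒜)` and have determinant `Q
^ ℓ`. Hence every prime factor of the determinant of a basis is a defining form. -/
theorem coeffDet_basis_dvd_pow (hform : ∀ H ∈ A.hyperplanes, LinearMap.ker (form H) = H)
    (b : Module.Basis (Fin ℓ) (MvPolynomial (Fin ℓ) K) A.logDer) :
    coeffDet (fun i => (b i : PolyDer K ℓ)) ∣ A.formProd form ^ ℓ := by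
  have h := coeffDet_dvd_of_eq_sum (b := fun i => (b i : PolyDer K ℓ))
    (N := fun i => A.formProd form • constDer (Pi.single i 1)) fun i => by
      refine exists_eq_sum_of_basis b ((mem_logDer_iff_dvd hform).2 fun H hH => ?_)
      rw [Derivation.smul_apply, smul_eq_mul]
      exact (Finset.dvd_prod_of_mem _ hH).mul_right _
  have h2 : coeffMatrix (fun i => A.formProd form • constDer (Pi.single i (1 : K)))
      = A.formProd form • (1 : Matrix (Fin ℓ) (Fin ℓ) (MvPolynomial (Fin ℓ) K)) := by
    ext i k : 2
    by_cases hik : i = k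
    · subst hik; simp [coeffMatrix, constDer]
    · simp [coeffMatrix, constDer, hik, Ne.symm hik]
  rwa [coeffDet.eq_1 (fun i => A.formProd form • _), h2, Matrix.det_smul, Fintype.card_fin,
    Matrix.det_one, mul_one] at h

open Classical in
-- Bounds the multiplicity of `α_H` by one: `ℓ` derivations in `D(𝒜)` are exhibited whose
-- determinant contains `α_H` only once.
theorem coeffDet_basis_dvd_erase_pow_mul
    (hform : ∀ H ∈ A.hyperplanes, LinearMap.ker (form H) = H)
    (b : Module.Basis (Fin ℓ) (MvPolynomial (Fin ℓ) K) A.logDer)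
    {H : Submodule K (Fin ℓ → K)} (hH : H ∈ A.hyperplanes) :
    coeffDet (fun i => (b i : PolyDer K ℓ)) ∣
      (∏ L ∈ A.hyperplanes.erase H, linearFormPoly (form L)) ^ ℓ * linearFormPoly (form H) := by
  set R := ∏ L ∈ A.hyperplanes.erase H, linearFormPoly (form L)
  set α := form H
  obtain ⟨v, hv⟩ := exists_dual_apply_eq_one (form_ne_zero hform hH)
  -- Chosen so that `∂_i + u_i ∂_v` sends `α` to `α(e_i) α`, while the rank-one perturbation has
  -- determinant `1 + (α - 1) α(v) = α`.
  set u : Fin ℓ → MvPolynomial (Fin ℓ) K :=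
    fun k => (linearFormPoly α - 1) * C (α (Pi.single k 1))
  have h := coeffDet_dvd_of_eq_sum (b := fun i => (b i : PolyDer K ℓ))
    (N := fun i => R • (constDer (Pi.single i 1) + u i • constDer v)) fun i => by
      refine exists_eq_sum_of_basis b ((mem_logDer_iff_dvd hform).2 fun L hL => ?_)
      simp only [Derivation.smul_apply, Derivation.add_apply, smul_eq_mul, constDer_linearFormPoly]
      by_cases hLH : L = H
      · rw [hLH, hv, C_1, mul_one]
        refine Dvd.dvd.mul_left ⟨C (α (Pi.single i 1)), ?_⟩ _
        simp only [u, α]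
        ring
      · exact (Finset.dvd_prod_of_mem _ (Finset.mem_erase.2 ⟨hLH, hL⟩)).mul_right _
  set T : Matrix (Fin ℓ) (Fin ℓ) (MvPolynomial (Fin ℓ) K) :=
    1 + Matrix.vecMulVec u (fun k => C (v k)) with hT
  have h2 : coeffMatrix (fun i => R • (constDer (Pi.single i (1 : K)) + u i • constDer v))
      = R • T := by
    refine Matrix.ext fun i k => ?_
    simp only [coeffMatrix, Matrix.of_apply, Matrix.smul_apply, hT, Matrix.add_apply,
      Matrix.vecMulVec_apply, Derivation.smul_apply, Derivation.add_apply, constDer,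
      mkDerivation_X, smul_eq_mul, Matrix.one_apply, Pi.single_apply, eq_comm (a := k)]
    split_ifs <;> simp
  have h3 : T.det = linearFormPoly α := by
    have h4 := eval_linearFormPoly α v
    simp only [linearFormPoly, map_sum, map_mul, eval_C, eval_X] at h4
    rw [hT, Matrix.det_one_add_vecMulVec]
    simp only [dotProduct, u, mul_left_comm (C _), ← Finset.mul_sum, ← C_mul, ← map_sum,
      mul_comm (v _), h4, α, hv, C_1]
    ring
  rwa [coeffDet.eq_1 (fun i => R • _), h2, Matrix.det_smul, Fintype.card_fin, h3] at h

/-- Saito's criterion, first half. -/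
theorem exists_coeffDet_basis_eq (hform : ∀ H ∈ A.hyperplanes, LinearMap.ker (form H) = H)
    (b : Module.Basis (Fin ℓ) (MvPolynomial (Fin ℓ) K) A.logDer) :
    ∃ c : K, c ≠ 0 ∧ coeffDet (fun i => (b i : PolyDer K ℓ)) = C c * A.formProd form := by
  classical
  obtain ⟨u, hu⟩ := formProd_dvd_coeffDet hform fun i => (b i).2
  have hpow := coeffDet_basis_dvd_pow hform b
  have hu0 : u ≠ 0 := by
    rintro rfl
    rw [mul_zero] at hu
    rw [hu, zero_dvd_iff] at hpow
    exact pow_ne_zero _ (formProd_ne_zero hform) hpow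
  have hunit : IsUnit u := by
    by_contra hnu
    obtain ⟨p, hp, hpu⟩ := WfDvdMonoid.exists_irreducible_factor hnu hu0
    have hp' := hp.prime
    have hpQ : p ∣ A.formProd form :=
      hp'.dvd_of_dvd_pow ((hpu.trans (hu ▸ dvd_mul_left _ _)).trans hpow)
    obtain ⟨H, hH, hpH⟩ := hp'.exists_mem_finset_dvd hpQ
    have hprime := linearFormPoly_prime (form_ne_zero hform hH)
    have hHu := (hp'.associated_of_dvd hprime hpH).symm.dvd.trans hpu
    -- A nonunit cofactor would make the determinant divisible by the square of some `α_H`, so `α_H`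
    -- would divide a power of the product of the other forms.
    have hsq : linearFormPoly (form H) * linearFormPoly (form H) ∣ A.formProd form * u :=
      mul_dvd_mul (Finset.dvd_prod_of_mem _ hH) hHu
    have hR := hsq.trans (hu ▸ coeffDet_basis_dvd_erase_pow_mul hform b hH)
    have hR2 := hprime.dvd_of_dvd_pow ((mul_dvd_mul_iff_right hprime.ne_zero).1 hR)
    obtain ⟨L, hL, hHL⟩ := hprime.exists_mem_finset_dvd hR2
    rw [Finset.mem_erase] at hL
    exact form_not_dvd hform hH hL.2 (Ne.symm hL.1) hHL
  obtain ⟨c, hc, rfl⟩ := isUnit_iff_eq_C_of_isReduced.1 hunit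
  exact ⟨c, hc.ne_zero, by rw [hu, mul_comm]⟩

/-- All Cramer numerators come from families in `D(𝒜)`, hence are divisible by the defining
polynomial. Keeping the coefficients as determinant quotients is what the exchange argument needs.
-/
theorem exists_eq_sum_of_coeffDet_eq
    (hform : ∀ H ∈ A.hyperplanes, LinearMap.ker (form H) = H)
    {b : Fin ℓ → PolyDer K ℓ} (hb : ∀ i, b i ∈ A.logDer) {c : K} (hc : c ≠ 0)
    (hdet : coeffDet b = C c * A.formProd form) {θ : PolyDer K ℓ} (hθ : θ ∈ A.logDer) :
    ∃ g : Fin ℓ → MvPolynomial (Fin ℓ) K, θ = ∑ i, g i • b i ∧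
      ∀ i, coeffDet b * g i = coeffDet (Function.update b i θ) := by
  have hQ := formProd_ne_zero hform
  have hdvd : ∀ i, coeffDet b ∣ coeffDet (Function.update b i θ) := fun i => by
    rw [hdet, (hc.isUnit.map C).mul_left_dvd]
    refine formProd_dvd_coeffDet hform fun j => ?_
    by_cases h : j = i
    · rwa [h, Function.update_self]
    · rw [Function.update_of_ne h]
      exact hb j
  choose g hg using hdvd
  refine ⟨g, derivation_ext fun k => ?_, fun i => (hg i).symm⟩
  have hne : coeffDet b ≠ 0 := by
    rw [hdet]
    exact mul_ne_zero (by simpa using hc) hQ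
  have h := congrArg (fun θ : PolyDer K ℓ => θ (X k)) (coeffDet_smul_eq_sum b θ)
  simp only [hg, mul_smul] at h
  rw [← Finset.smul_sum] at h
  exact mul_left_cancel₀ hne h

/-- Saito's criterion, second half. -/
theorem exists_basis_of_coeffDet_eq
    (hform : ∀ H ∈ A.hyperplanes, LinearMap.ker (form H) = H)
    {b : Fin ℓ → PolyDer K ℓ} (hb : ∀ i, b i ∈ A.logDer) {c : K} (hc : c ≠ 0)
    (hdet : coeffDet b = C c * A.formProd form) :
    ∃ B : Module.Basis (Fin ℓ) (MvPolynomial (Fin ℓ) K) A.logDer,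
      ∀ i, (B i : PolyDer K ℓ) = b i := by
  have hne : coeffDet b ≠ 0 := by
    rw [hdet]
    exact mul_ne_zero (by simpa using hc) (formProd_ne_zero hform)
  have hli : LinearIndependent (MvPolynomial (Fin ℓ) K) fun i => (⟨b i, hb i⟩ : A.logDer) :=
    LinearIndependent.of_comp A.logDer.subtype (linearIndependent_of_coeffDet_ne_zero hne)
  refine ⟨Module.Basis.mk hli ?_, fun i => by rw [Module.Basis.mk_apply]⟩
  rintro ⟨θ, hθ⟩ -
  obtain ⟨g, hg, -⟩ := exists_eq_sum_of_coeffDet_eq hform hb hc hdet hθ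
  have : (⟨θ, hθ⟩ : A.logDer) = ∑ i, g i • (⟨b i, hb i⟩ : A.logDer) := by
    refine Subtype.ext ?_
    rw [← A.logDer.subtype_apply (∑ i, _), map_sum]
    exact hg
  rw [this]
  exact Submodule.sum_mem _ fun i _ =>
    Submodule.smul_mem _ _ (Submodule.subset_span (Set.mem_range_self i))

theorem sum_degrees_eq_card {b : Fin ℓ → PolyDer K ℓ} {d : Fin ℓ → ℕ}
    (hform : ∀ H ∈ A.hyperplanes, LinearMap.ker (form H) = H)
    (hd : ∀ i, (b i).IsHomogeneousOfDegree (d i)) {c : K} (hc : c ≠ 0)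
    (hdet : coeffDet b = C c * A.formProd form) : ∑ i, d i = A.hyperplanes.card := by
  refine (coeffDet_isHomogeneous hd).inj_right
    (hdet ▸ (A.formProd_isHomogeneous form).C_mul c) ?_
  rw [hdet]
  exact mul_ne_zero (by simpa using hc) (formProd_ne_zero hform)

/-- The defining polynomial divides the determinant and has the same degree, so the quotient is a
constant. -/
theorem exists_coeffDet_eq_of_isHomogeneous {b : Fin ℓ → PolyDer K ℓ} {d : Fin ℓ → ℕ}
    (hform : ∀ H ∈ A.hyperplanes, LinearMap.ker (form H) = H)
    (hb : ∀ i, b i ∈ A.logDer) (hd : ∀ i, (b i).IsHomogeneousOfDegree (d i))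
    (hsum : ∑ i, d i = A.hyperplanes.card) (hne : coeffDet b ≠ 0) :
    ∃ c : K, c ≠ 0 ∧ coeffDet b = C c * A.formProd form := by
  obtain ⟨u, hu⟩ := formProd_dvd_coeffDet hform hb
  have h := ((A.formProd_isHomogeneous form).of_mul_left (formProd_ne_zero hform)
    (hu ▸ coeffDet_isHomogeneous hd)).1
  rw [hsum, Nat.sub_self] at h
  have h2 := totalDegree_eq_zero_iff_eq_C.1 ((totalDegree_zero_iff_isHomogeneous _).2 h)
  refine ⟨coeff 0 u, fun h0 => hne ?_, by rw [hu, mul_comm]; exact congrArg (· * _) h2⟩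
  rw [hu, h2, h0, C_0, mul_zero]

end HyperplaneArrangement

end Saito

/-! ### Restriction to a hyperplane and the derivation of degree `|A| - |A^H| - 1` -/

section Restriction

variable {K : Type*} [Field K] {ℓ : ℕ}

theorem linSubst_projAlong_eq {α : Module.Dual K (Fin ℓ → K)} (v : Fin ℓ → K)
    {R : Type*} [CommRing R] {σ : MvPolynomial (Fin ℓ) K →+* R} (hσ : σ (linearFormPoly α) = 0)
    (f : MvPolynomial (Fin ℓ) K) : σ (linSubst (projAlong α v) f) = σ f := by
  obtain ⟨g, hg⟩ := linearFormPoly_dvd_sub_linSubst α v f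
  rw [eq_comm, ← sub_eq_zero, ← map_sub, hg, map_mul, hσ, zero_mul]

theorem linSubst_projAlong_self {α : Module.Dual K (Fin ℓ → K)} {v : Fin ℓ → K} (hv : α v = 1) :
    linSubst (projAlong α v) (linearFormPoly α) = 0 :=
  (linearFormPoly_dvd_iff hv).1 dvd_rfl

theorem inf_le_of_ker_comp_projAlong_le {α β γ : Module.Dual K (Fin ℓ → K)} {v : Fin ℓ → K}
    (h : LinearMap.ker (β ∘ₗ projAlong α v) ≤ LinearMap.ker (γ ∘ₗ projAlong α v)) :
    LinearMap.ker α ⊓ LinearMap.ker β ≤ LinearMap.ker α ⊓ LinearMap.ker γ := by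
  rw [comp_projAlong, comp_projAlong] at h
  rintro w ⟨h1, h2⟩
  have h3 : w ∈ LinearMap.ker (β - β v • α) := by
    simp_all
  have h4 := h h3
  simp_all

namespace HyperplaneArrangement

variable {A : HyperplaneArrangement K ℓ}
  {form : Submodule K (Fin ℓ → K) → Module.Dual K (Fin ℓ → K)}
  {H : Submodule K (Fin ℓ → K)} {v : Fin ℓ → K}

theorem form_comp_projAlong_ne_zero (hform : ∀ H ∈ A.hyperplanes, LinearMap.ker (form H) = H)
    (hH : H ∈ A.hyperplanes) (hv : form H v = 1) {L : Submodule K (Fin ℓ → K)}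
    (hL : L ∈ A.hyperplanes) (hLH : L ≠ H) : form L ∘ₗ projAlong (form H) v ≠ 0 := by
  rw [Ne, ← linearFormPoly_eq_zero_iff, ← linSubst_linearFormPoly, ← linearFormPoly_dvd_iff hv]
  exact form_not_dvd hform hH hL hLH.symm

theorem linSubst_form_isRelPrime (hform : ∀ H ∈ A.hyperplanes, LinearMap.ker (form H) = H)
    (hH : H ∈ A.hyperplanes) (hv : form H v = 1) {L M : Submodule K (Fin ℓ → K)}
    (hL : L ∈ A.hyperplanes) (hLH : L ≠ H) (hM : M ∈ A.hyperplanes) (hMH : M ≠ H)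
    (h : H ⊓ L ≠ H ⊓ M) :
    IsRelPrime (linSubst (projAlong (form H) v) (linearFormPoly (form L)))
      (linSubst (projAlong (form H) v) (linearFormPoly (form M))) := by
  have hL0 := form_comp_projAlong_ne_zero hform hH hv hL hLH
  have hM0 := form_comp_projAlong_ne_zero hform hH hv hM hMH
  rw [linSubst_linearFormPoly, linSubst_linearFormPoly]
  have hLp := linearFormPoly_prime hL0
  have hMp := linearFormPoly_prime hM0
  refine hLp.irreducible.isRelPrime_iff_not_dvd.2 fun hd => h (le_antisymm ?_ ?_)
  · have := inf_le_of_ker_comp_projAlong_le (linearFormPoly_dvd_linearFormPoly hL0 hd)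
    rwa [hform H hH, hform L hL, hform M hM] at this
  · have := inf_le_of_ker_comp_projAlong_le
      (linearFormPoly_dvd_linearFormPoly hM0 (hLp.associated_of_dvd hMp hd).symm.dvd)
    rwa [hform H hH, hform L hL, hform M hM] at this

theorem exists_restriction_section (A : HyperplaneArrangement K ℓ)
    (H : Submodule K (Fin ℓ → K)) :
    ∃ ν : Submodule K (Fin ℓ → K) → Submodule K (Fin ℓ → K),
      ∀ Y ∈ A.restriction H, ν Y ∈ A.hyperplanes ∧ ν Y ≠ H ∧ H ⊓ ν Y = Y := by
  classical
  have h : ∀ Y, ∃ L, Y ∈ A.restriction H → L ∈ A.hyperplanes ∧ L ≠ H ∧ H ⊓ L = Y := by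
    intro Y
    by_cases hY : Y ∈ A.restriction H
    · obtain ⟨L, hL, hLY⟩ := Finset.mem_image.1 hY
      rw [Finset.mem_erase] at hL
      exact ⟨L, fun _ => ⟨hL.2, hL.1, hLY⟩⟩
    · exact ⟨⊤, fun h => absurd h hY⟩
  choose ν hν using h
  exact ⟨ν, hν⟩

theorem inf_mem_restriction {L : Submodule K (Fin ℓ → K)} (hL : L ∈ A.hyperplanes)
    (hLH : L ≠ H) : H ⊓ L ∈ A.restriction H := by
  classical
  exact Finset.mem_image.2 ⟨L, Finset.mem_erase.2 ⟨hLH, hL⟩, rfl⟩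

/-- Evaluate the rows at `β - β(v) α_H`, where `β` defines `ν Y`. Row `i` gives zero, because this
form kills `v`; the other rows give a multiple of `β` plus a multiple of `α_H`, and the latter
restricts to zero. Distinct `Y` give coprime restricted forms. -/
theorem linSubst_prod_section_dvd (hform : ∀ H ∈ A.hyperplanes, LinearMap.ker (form H) = H)
    (hH : H ∈ A.hyperplanes) (hv : form H v = 1)
    {ν : Submodule K (Fin ℓ → K) → Submodule K (Fin ℓ → K)}
    (hν : ∀ Y ∈ A.restriction H, ν Y ∈ A.hyperplanes ∧ ν Y ≠ H ∧ H ⊓ ν Y = Y)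
    {b : Fin ℓ → PolyDer K ℓ} (hb : ∀ i, b i ∈ A.logDer) (i : Fin ℓ) :
    linSubst (projAlong (form H) v) (∏ Y ∈ A.restriction H, linearFormPoly (form (ν Y))) ∣
      linSubst (projAlong (form H) v) (coeffDet (Function.update b i (constDer v))) := by
  rw [map_prod]
  refine Finset.prod_dvd_of_isRelPrime (fun Y hY Z hZ hYZ => ?_) fun Y hY => ?_
  · obtain ⟨h1, h2, h3⟩ := hν Y hY
    obtain ⟨h4, h5, h6⟩ := hν Z hZ
    exact linSubst_form_isRelPrime hform hH hv h1 h2 h4 h5 (by rwa [h3, h6])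
  · obtain ⟨h1, h2, -⟩ := hν Y hY
    refine linearFormPoly_dvd_det (linSubst (projAlong (form H) v)).toRingHom
      (form_comp_projAlong_ne_zero hform hH hv h1 h2) fun j => ?_
    change _ ∣ linSubst (projAlong (form H) v) _
    by_cases hji : j = i
    · rw [hji, Function.update_self, constDer_linearFormPoly, comp_projAlong]
      simp [hv]
    · rw [Function.update_of_ne hji, comp_projAlong, linearFormPoly_sub, linearFormPoly_smul,
        map_sub, map_sub]
      refine dvd_sub (map_dvd _ ((mem_logDer_iff_dvd hform).1 (hb j) _ h1)) ?_
      obtain ⟨c, hc⟩ := (mem_logDer_iff_dvd hform).1 (hb j) H hH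
      rw [Derivation.leibniz, hc]
      simp [linSubst_projAlong_self hv]

/-- Otherwise Cramer's relation could be divided by `α_H`, placing `(det/α_H) ∂_v` in `D(𝒜)`; its
value at `α_H` is prime to `α_H`. -/
theorem exists_not_dvd_coeffDet_update
    (b : Module.Basis (Fin ℓ) (MvPolynomial (Fin ℓ) K) A.logDer)
    (hform : ∀ H ∈ A.hyperplanes, LinearMap.ker (form H) = H)
    (hH : H ∈ A.hyperplanes) (hv : form H v = 1) :
    ∃ i, ¬ linearFormPoly (form H) ∣
      coeffDet (Function.update (fun i => (b i : PolyDer K ℓ)) i (constDer v)) := by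
  classical
  by_contra! hD
  choose D hD using hD
  obtain ⟨c, hc, hdet⟩ := exists_coeffDet_basis_eq hform b
  have hprime := linearFormPoly_prime (form_ne_zero hform hH)
  set R := C c * ∏ L ∈ A.hyperplanes.erase H, linearFormPoly (form L) with hR
  have hsmul : linearFormPoly (form H) • (R • constDer v) =
      linearFormPoly (form H) • ∑ i, D i • (b i : PolyDer K ℓ) := by
    rw [Finset.smul_sum]
    simp only [smul_smul, ← hD]
    rw [← coeffDet_smul_eq_sum (fun i => (b i : PolyDer K ℓ)), hdet, formProd,
      ← Finset.mul_prod_erase _ _ hH, mul_left_comm]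
  have hmem : R • constDer v ∈ A.logDer := by
    have : R • constDer v = ∑ i, D i • (b i : PolyDer K ℓ) := derivation_ext fun k =>
      mul_left_cancel₀ hprime.ne_zero (congrArg (fun θ : PolyDer K ℓ => θ (X k)) hsmul)
    rw [this]
    exact Submodule.sum_mem _ fun i _ => Submodule.smul_mem _ _ (b i).2
  have hfin := (mem_logDer_iff_dvd hform).1 hmem H hH
  rw [Derivation.smul_apply, constDer_linearFormPoly, hv, C_1, smul_eq_mul, mul_one, hR,
    (hc.isUnit.map C).dvd_mul_left] at hfin
  obtain ⟨L, hL, hHL⟩ := hprime.exists_mem_finset_dvd hfin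
  rw [Finset.mem_erase] at hL
  exact form_not_dvd hform hH hL.2 (Ne.symm hL.1) hHL

theorem coeffDet_update_constDer_isHomogeneous {b : Fin ℓ → PolyDer K ℓ} {d : Fin ℓ → ℕ}
    (hd : ∀ i, (b i).IsHomogeneousOfDegree (d i)) (i : Fin ℓ) (v : Fin ℓ → K) :
    (coeffDet (Function.update b i (constDer v))).IsHomogeneous
      (∑ j ∈ Finset.univ.erase i, d j) := by
  have h := coeffDet_isHomogeneous (b := Function.update b i (constDer v))
    (d := Function.update d i 0) fun j => by
      by_cases hji : j = i
      · rw [hji, Function.update_self, Function.update_self]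
        exact constDer_isHomogeneousOfDegree v
      · rw [Function.update_of_ne hji, Function.update_of_ne hji]
        exact hd j
  rwa [Finset.sum_update_of_mem (Finset.mem_univ i), zero_add,
    Finset.sdiff_singleton_eq_erase] at h

/-- A homogeneous relation of degree `|A| - |A^H|` among the restrictions to `H` of a homogeneous
basis of `D(A)`. -/
theorem exists_relation_mod_form (hform : ∀ H ∈ A.hyperplanes, LinearMap.ker (form H) = H)
    {b : Fin ℓ → PolyDer K ℓ} {d : Fin ℓ → ℕ} (hb : ∀ i, b i ∈ A.logDer)
    (hd : ∀ i, (b i).IsHomogeneousOfDegree (d i)) (hsum : ∑ i, d i = A.hyperplanes.card)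
    (hH : H ∈ A.hyperplanes) (hv : form H v = 1) {e : ℕ}
    (he : (A.restriction H).card + e = A.hyperplanes.card) :
    ∃ g : Fin ℓ → MvPolynomial (Fin ℓ) K, (∀ i k, (g i * b i (X k)).IsHomogeneous e) ∧
      (∀ k, linearFormPoly (form H) ∣ (∑ i, g i • b i) (X k)) ∧
      ∀ i, linearFormPoly (form H) ∣ g i →
        linearFormPoly (form H) ∣ coeffDet (Function.update b i (constDer v)) := by
  obtain ⟨ν, hν⟩ := A.exists_restriction_section H
  set ρ := linSubst (projAlong (form H) v) with hρ
  set Q := ∏ Y ∈ A.restriction H, linearFormPoly (form (ν Y)) with hQ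
  have hρρ : ∀ f, ρ (ρ f) = ρ f :=
    linSubst_projAlong_eq v (σ := ρ.toRingHom) (linSubst_projAlong_self hv)
  have hQhom : (ρ Q).IsHomogeneous (A.restriction H).card := by
    have := IsHomogeneous.prod (A.restriction H) (fun Y => linearFormPoly (form (ν Y)))
      (fun _ => 1) fun Y _ => linearFormPoly_isHomogeneous (form (ν Y))
    rw [Finset.sum_const, smul_eq_mul, mul_one] at this
    exact linSubst_isHomogeneous _ this
  have hQ0 : ρ Q ≠ 0 := by
    rw [hQ, map_prod, Finset.prod_ne_zero_iff]
    intro Y hY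
    rw [hρ, linSubst_linearFormPoly, Ne, linearFormPoly_eq_zero_iff]
    exact form_comp_projAlong_ne_zero hform hH hv (hν Y hY).1 (hν Y hY).2.1
  choose g hg using fun i => linSubst_prod_section_dvd hform hH hv hν hb i
  rw [← hρ, ← hQ] at hg
  refine ⟨g, fun i k => ?_, fun k => ?_, fun i hi => ?_⟩
  · have hn := Finset.sum_erase_add _ d (Finset.mem_univ i)
    obtain ⟨h1, h2⟩ := hQhom.of_mul_left hQ0
      (hg i ▸ linSubst_isHomogeneous _ (coeffDet_update_constDer_isHomogeneous hd i v))
    -- The numerator may have degree below `|A^H|`; then `g i = 0`. This is why homogeneity is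
    -- stated for the product `g i * b i (X k)`.
    by_cases hlt : ∑ j ∈ Finset.univ.erase i, d j < (A.restriction H).card
    · rw [h2 hlt, zero_mul]
      exact isHomogeneous_zero _ _ _
    · have := h1.mul (PolyDer.isHomogeneousOfDegree_iff.1 (hd i) k)
      rwa [show ∑ j ∈ Finset.univ.erase i, d j - (A.restriction H).card + d i = e by omega] at this
  · rw [linearFormPoly_dvd_iff hv]
    refine (mul_eq_zero.1 (?_ : ρ Q * ρ _ = 0)).resolve_left hQ0
    -- The quotients `g i` need not be fixed by `ρ`; idempotence of `ρ` lets the relation be checked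
    -- after restriction and multiplication by `ρ Q`.
    have h : ∀ i, ρ Q * ρ (g i * b i (X k)) =
        ρ (coeffDet (Function.update b i (constDer v)) * b i (X k)) := fun i => by
      rw [map_mul, map_mul, ← mul_assoc, ← hρρ Q, ← map_mul, ← hg, hρρ]
    rw [sum_smul_apply, map_sum, Finset.mul_sum, Finset.sum_congr rfl fun i _ => h i, ← map_sum,
      ← sum_smul_apply, ← coeffDet_smul_eq_sum, Derivation.smul_apply, smul_eq_mul]
    exact (linearFormPoly_dvd_iff hv).1
      (((Finset.dvd_prod_of_mem _ hH).trans (formProd_dvd_coeffDet hform hb)).mul_right _)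
  · rw [linearFormPoly_dvd_iff hv] at hi ⊢
    rw [← hρ] at hi ⊢
    rw [← hρρ, hg, map_mul, hi, mul_zero]

theorem dvd_of_smul_mem_logDer {α : Module.Dual K (Fin ℓ → K)}
    (hα : LinearMap.ker α ∈ A.hyperplanes)
    {η : PolyDer K ℓ} (hη : linearFormPoly α • η ∈ A.logDer) {β : Module.Dual K (Fin ℓ → K)}
    (hβ : LinearMap.ker β ∈ A.hyperplanes) (hne : LinearMap.ker β ≠ LinearMap.ker α) :
    linearFormPoly β ∣ η (linearFormPoly β) := by
  have h := Ideal.mem_span_singleton.1 (hη _ hβ β rfl)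
  rw [Derivation.smul_apply, smul_eq_mul] at h
  have hβ0 : β ≠ 0 := codim_ker_eq_one_iff.1 (A.codim_eq_one _ hβ)
  exact ((linearFormPoly_prime hβ0).dvd_or_dvd h).resolve_left fun hd =>
    not_le_of_ne hβ hα hne (linearFormPoly_dvd_linearFormPoly hβ0 hd)

/-- If `A` is free with homogeneous basis `b`, then for every `H ∈ A` some derivation of degree
`|A| - |A^H| - 1` is logarithmic for `A ∖ {H}` but not for `A`. -/
theorem exists_derivation_of_basis
    (b : Module.Basis (Fin ℓ) (MvPolynomial (Fin ℓ) K) A.logDer) {d : Fin ℓ → ℕ}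
    (hd : ∀ i, (b i : PolyDer K ℓ).IsHomogeneousOfDegree (d i)) (hH : H ∈ A.hyperplanes)
    {α : Module.Dual K (Fin ℓ → K)} (hα : LinearMap.ker α = H) {e : ℕ}
    (he : (A.restriction H).card + e = A.hyperplanes.card) :
    ∃ η : PolyDer K ℓ, η.IsHomogeneousOfDegree (e - 1) ∧ linearFormPoly α • η ∈ A.logDer ∧
      PolyDer.IsHomogeneousOfDegree (linearFormPoly α • η) e ∧
      ¬ linearFormPoly α ∣ η (linearFormPoly α) := by
  obtain ⟨form, hform, rfl⟩ := A.exists_form_eq hα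
  have hα0 := form_ne_zero hform hH
  obtain ⟨v, hv⟩ := exists_dual_apply_eq_one hα0
  obtain ⟨c, hc, hdet⟩ := exists_coeffDet_basis_eq hform b
  obtain ⟨g, hghom, hgdvd, hgD⟩ := exists_relation_mod_form hform (fun i => (b i).2) hd
    (sum_degrees_eq_card hform hd hc hdet) hH hv he
  obtain ⟨η, hη⟩ := eq_smul_of_forall_dvd hgdvd
  have hmem : linearFormPoly (form H) • η ∈ A.logDer :=
    hη ▸ Submodule.sum_mem _ fun i _ => Submodule.smul_mem _ _ (b i).2
  have hhom : PolyDer.IsHomogeneousOfDegree (linearFormPoly (form H) • η) e := by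
    rw [← hη, PolyDer.isHomogeneousOfDegree_iff]
    intro k
    rw [sum_smul_apply]
    exact IsHomogeneous.sum _ _ _ fun i _ => hghom i k
  refine ⟨η, hhom.of_smul hα0, hmem, hhom, fun hdα => ?_⟩
  have hηA : η ∈ A.logDer := (mem_logDer_iff_dvd hform).2 fun L hL => by
    by_cases hLH : L = H
    · rwa [hLH]
    · exact dvd_of_smul_mem_logDer (by rwa [hform H hH]) hmem (by rwa [hform L hL])
        (by rwa [hform L hL, hform H hH])
  obtain ⟨h, hh⟩ := exists_eq_sum_of_basis b hηA
  have hdet0 : coeffDet (fun i => (b i : PolyDer K ℓ)) ≠ 0 := by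
    rw [hdet]
    exact mul_ne_zero (by simpa using hc) (formProd_ne_zero hform)
  -- Two expansions of `α η` in the basis: uniqueness forces `g i = α h i`, hence `α` divides every
  -- Cramer numerator.
  have h0 : ∑ i, (g i - linearFormPoly (form H) * h i) • (b i : PolyDer K ℓ) = 0 := by
    refine derivation_ext fun k => ?_
    have h1 := congrArg (fun θ : PolyDer K ℓ => θ (X k)) hη
    have h2 := congrArg (fun θ : PolyDer K ℓ => θ (X k)) hh
    simp only [sum_smul_apply, Derivation.smul_apply, smul_eq_mul] at h1 h2
    simp only [sum_smul_apply, sub_mul, Finset.sum_sub_distrib, mul_assoc]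
    rw [← Finset.mul_sum, ← h2, h1, sub_self, Derivation.zero_apply]
  have hgh := Fintype.linearIndependent_iff.1 (linearIndependent_of_coeffDet_ne_zero hdet0) _ h0
  obtain ⟨i, hi⟩ := exists_not_dvd_coeffDet_update b hform hH hv
  exact hi (hgD i ⟨h i, sub_eq_zero.1 (hgh i)⟩)

/-! ### Terao's polynomial -/

/-- If `η` is logarithmic along `L` and `M`, where `H ∩ L = H ∩ M`, and `η(α_M) = α_M a`, then
`α_L` divides `η(α_H) - α_H a`. -/
theorem form_dvd_sub_of_inf_eq (hform : ∀ H ∈ A.hyperplanes, LinearMap.ker (form H) = H)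
    (hH : H ∈ A.hyperplanes) {η : PolyDer K ℓ} {L M : Submodule K (Fin ℓ → K)}
    (hL : L ∈ A.hyperplanes) (hM : M ∈ A.hyperplanes) (hLM : L ≠ M)
    (hY : H ⊓ L = H ⊓ M) (hηL : linearFormPoly (form L) ∣ η (linearFormPoly (form L)))
    {a : MvPolynomial (Fin ℓ) K}
    (ha : η (linearFormPoly (form M)) = linearFormPoly (form M) * a) :
    linearFormPoly (form L) ∣ η (linearFormPoly (form H)) - linearFormPoly (form H) * a := by
  have hspan := mem_span_of_iInf_ker_le_ker (L := ![form H, form M]) (K := form L) (by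
    intro w hw
    simp only [Submodule.mem_iInf, Fin.forall_fin_two] at hw
    simp only [Matrix.cons_val_zero, Matrix.cons_val_one, hform H hH, hform M hM] at hw
    have : w ∈ H ⊓ L := hY ▸ hw
    rw [hform L hL]
    exact this.2)
  rw [Matrix.range_cons, Matrix.range_cons, Matrix.range_empty, Set.union_empty,
    Set.singleton_union, Submodule.mem_span_pair] at hspan
  obtain ⟨t, s, hts⟩ := hspan
  -- If `t = 0`, then `α_L` is a multiple of `α_M` and the two hyperplanes coincide.
  have ht : t ≠ 0 := by
    rintro rfl
    refine not_le_of_ne hM hL hLM.symm ?_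
    intro w hw
    rw [← hform M hM, LinearMap.mem_ker] at hw
    rw [← hform L hL, LinearMap.mem_ker, ← hts]
    simp [hw]
  have hL2 : linearFormPoly (form L) =
      C t * linearFormPoly (form H) + C s * linearFormPoly (form M) := by
    rw [← hts, linearFormPoly_add, linearFormPoly_smul, linearFormPoly_smul]
  have hη2 : η (linearFormPoly (form L)) =
      C t * η (linearFormPoly (form H)) + C s * η (linearFormPoly (form M)) := by
    rw [hL2, map_add, Derivation.leibniz, Derivation.leibniz]
    simp
  have key : C t * (η (linearFormPoly (form H)) - linearFormPoly (form H) * a) =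
      η (linearFormPoly (form L)) - linearFormPoly (form L) * a := by
    rw [hη2, ha, hL2]
    ring
  rw [← (ht.isUnit.map C).dvd_mul_left, key]
  exact dvd_sub hηL (dvd_mul_right _ _)

/-- If `η` has degree `|A| - |A^H| - 1`, is logarithmic for `A ∖ {H}` but not for `A`, then
`η(α_H)` is modulo `α_H` a nonzero multiple of Terao's polynomial `B`; so it survives under ring
homomorphisms that kill `α_H` but no factor of `B`. -/
theorem map_apply_ne_zero (hH : H ∈ A.hyperplanes)
    {α : Module.Dual K (Fin ℓ → K)} (hα : LinearMap.ker α = H) {e : ℕ}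
    (he : (A.restriction H).card + e = A.hyperplanes.card) {η : PolyDer K ℓ}
    (hη : η.IsHomogeneousOfDegree (e - 1))
    (hlog : ∀ β : Module.Dual K (Fin ℓ → K), LinearMap.ker β ∈ A.hyperplanes →
      LinearMap.ker β ≠ H → linearFormPoly β ∣ η (linearFormPoly β))
    (hnot : ¬ linearFormPoly α ∣ η (linearFormPoly α))
    {R : Type*} [CommRing R] [IsDomain R] {σ : MvPolynomial (Fin ℓ) K →+* R}
    (hσα : σ (linearFormPoly α) = 0)
    (hσ : ∀ β : Module.Dual K (Fin ℓ → K), LinearMap.ker β ∈ A.hyperplanes →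
      LinearMap.ker β ≠ H →
      (∃ L ∈ A.hyperplanes, L ≠ H ∧ L ≠ LinearMap.ker β ∧ H ⊓ L = H ⊓ LinearMap.ker β) →
      σ (linearFormPoly β) ≠ 0) :
    σ (η (linearFormPoly α)) ≠ 0 := by
  classical
  obtain ⟨form, hform, rfl⟩ := A.exists_form_eq hα
  have hα0 := form_ne_zero hform hH
  obtain ⟨v, hv⟩ := exists_dual_apply_eq_one hα0
  obtain ⟨ν, hν⟩ := A.exists_restriction_section H
  set α := form H
  set ρ := linSubst (projAlong α v)
  -- The factors of `B`: all hyperplanes other than `H` and the chosen representatives `ν Y`, so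
  -- `|A| - 1 - |A^H| = e - 1` of them.
  set T := A.hyperplanes.erase H \ (A.restriction H).image ν with hT
  have hTmem : ∀ L ∈ T, L ∈ A.hyperplanes ∧ L ≠ H ∧ H ⊓ L ∈ A.restriction H ∧
      ν (H ⊓ L) ≠ L := fun L hL => by
    rw [hT, Finset.mem_sdiff, Finset.mem_erase] at hL
    have hr := inf_mem_restriction hL.1.2 hL.1.1
    exact ⟨hL.1.2, hL.1.1, hr, fun h => hL.2 (Finset.mem_image.2 ⟨_, hr, h⟩)⟩
  have hcard : T.card = e - 1 := by
    have hsub : (A.restriction H).image ν ⊆ A.hyperplanes.erase H := by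
      intro L hL
      obtain ⟨Y, hY, rfl⟩ := Finset.mem_image.1 hL
      exact Finset.mem_erase.2 ⟨(hν Y hY).2.1, (hν Y hY).1⟩
    have hinj : ((A.restriction H).image ν).card = (A.restriction H).card := by
      refine Finset.card_image_of_injOn fun Y hY Z hZ h => ?_
      rw [← (hν Y hY).2.2, ← (hν Z hZ).2.2, h]
    rw [hT, Finset.card_sdiff_of_subset hsub, hinj, Finset.card_erase_of_mem hH]
    omega
  set B := ∏ L ∈ T, linearFormPoly (form L)
  have hform_log : ∀ L ∈ A.hyperplanes, L ≠ H →
      linearFormPoly (form L) ∣ η (linearFormPoly (form L)) := fun L hL hLH => by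
    have := hlog (form L)
    rw [hform L hL] at this
    exact this hL hLH
  have hdvd : ρ B ∣ ρ (η (linearFormPoly α)) := by
    have hB : B = ∏ Y ∈ A.restriction H, ∏ L ∈ T with H ⊓ L = Y, linearFormPoly (form L) :=
      (Finset.prod_fiberwise_of_maps_to (fun L hL => (hTmem L hL).2.2.1) _).symm
    rw [hB, map_prod]
    refine Finset.prod_dvd_of_isRelPrime (fun Y _ Z _ hYZ => ?_) fun Y hY => ?_
    · rw [Function.onFun, map_prod, map_prod]
      refine IsRelPrime.prod_left fun L hL => IsRelPrime.prod_right fun M hM => ?_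
      rw [Finset.mem_filter] at hL hM
      obtain ⟨hL1, hL2, -⟩ := hTmem L hL.1
      obtain ⟨hM1, hM2, -⟩ := hTmem M hM.1
      exact linSubst_form_isRelPrime hform hH hv hL1 hL2 hM1 hM2 (by rwa [hL.2, hM.2])
    · obtain ⟨hν1, hν2, hν3⟩ := hν Y hY
      obtain ⟨a, ha⟩ := hform_log _ hν1 hν2
      -- Forms over the same `Y` become proportional on `H`, so coprimality must be used before
      -- restricting. One `a`, taken from `ν Y`, serves the whole fibre.
      have h : ∏ L ∈ T with H ⊓ L = Y, linearFormPoly (form L) ∣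
          η (linearFormPoly α) - linearFormPoly α * a := by
        refine Finset.prod_dvd_of_isRelPrime (fun L hL M hM hLM => ?_) fun L hL => ?_
        · rw [Finset.mem_coe, Finset.mem_filter] at hL hM
          exact form_isRelPrime hform (hTmem L hL.1).1 (hTmem M hM.1).1 hLM
        · rw [Finset.mem_filter] at hL
          obtain ⟨hL1, hL2, hL3, hL4⟩ := hTmem L hL.1
          rw [hL.2] at hL4
          exact form_dvd_sub_of_inf_eq hform hH hL1 hν1 hL4.symm (hL.2.trans hν3.symm)
            (hform_log L hL1 hL2) ha
      have h2 := map_dvd ρ h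
      rwa [map_sub, map_mul, linSubst_projAlong_self hv, zero_mul, sub_zero] at h2
  obtain ⟨u, hu⟩ := hdvd
  have hB0 : ρ B ≠ 0 := by
    rw [map_prod, Finset.prod_ne_zero_iff]
    intro L hL
    rw [linSubst_linearFormPoly, Ne, linearFormPoly_eq_zero_iff]
    exact form_comp_projAlong_ne_zero hform hH hv (hTmem L hL).1 (hTmem L hL).2.1
  have hBhom : (ρ B).IsHomogeneous (e - 1) := by
    have := IsHomogeneous.prod T (fun L => linearFormPoly (form L))
      (fun _ => 1) fun L _ => linearFormPoly_isHomogeneous (form L)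
    rw [Finset.sum_const, smul_eq_mul, mul_one, hcard] at this
    exact linSubst_isHomogeneous _ this
  have huhom := (hBhom.of_mul_left hB0 (hu ▸ linSubst_isHomogeneous _ (hη α))).1
  rw [Nat.sub_self] at huhom
  have huC := totalDegree_eq_zero_iff_eq_C.1 ((totalDegree_zero_iff_isHomogeneous _).2 huhom)
  have hu0 : coeff 0 u ≠ 0 := fun h0 => by
    rw [huC, h0, C_0, mul_zero] at hu
    exact hnot ((linearFormPoly_dvd_iff hv).2 hu)
  rw [← linSubst_projAlong_eq v hσα, hu, map_mul, linSubst_projAlong_eq v hσα, huC]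
  refine mul_ne_zero ?_ ((hu0.isUnit.map C).map σ).ne_zero
  rw [map_prod, Finset.prod_ne_zero_iff]
  intro L hL
  obtain ⟨hL1, hL2, hL3, hL4⟩ := hTmem L hL
  have := hσ (form L)
  rw [hform L hL1] at this
  exact this hL1 hL2 ⟨ν (H ⊓ L), (hν _ hL3).1, (hν _ hL3).2.1, hL4, (hν _ hL3).2.2⟩

end HyperplaneArrangement

end Restriction

/-! ### Degree-preserving exchange of basis elements -/

section Exchange

variable {K : Type*} [Field K] {ℓ : ℕ}

theorem coeffDet_comp_perm_ne_zero {b : Fin ℓ → PolyDer K ℓ} (h : coeffDet b ≠ 0)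
    (τ : Equiv.Perm (Fin ℓ)) : coeffDet (fun i => b (τ i)) ≠ 0 := by
  have h1 : coeffMatrix (fun i => b (τ i)) = (coeffMatrix b).submatrix τ id := rfl
  rw [coeffDet, h1, Matrix.det_permute]
  refine mul_ne_zero ?_ h
  rcases Int.units_eq_one_or (Equiv.Perm.sign τ) with hs | hs <;> simp [hs]

/-- Steinitz exchange that respects degrees. -/
theorem HyperplaneArrangement.exists_coeffDet_ne_zero_extending {A : HyperplaneArrangement K ℓ}
    {b φ : Fin ℓ → PolyDer K ℓ} {d : Fin ℓ → ℕ} (hmono : Monotone d)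
    (hb : ∀ i, b i ∈ A.logDer) (hd : ∀ i, (b i).IsHomogeneousOfDegree (d i))
    (hsum : ∑ i, d i = A.hyperplanes.card) (hdet : coeffDet b ≠ 0) {q : ℕ} (hq : q ≤ ℓ)
    (hφ : ∀ i : Fin ℓ, i.val < q → φ i ∈ A.logDer ∧ (φ i).IsHomogeneousOfDegree (d i))
    (hindep : ∀ k : Fin ℓ, k.val < q → ∀ f : Fin ℓ → MvPolynomial (Fin ℓ) K,
      φ k ≠ ∑ i ∈ Finset.Iio k, f i • φ i) :
    ∃ b' : Fin ℓ → PolyDer K ℓ, (∀ i, b' i ∈ A.logDer) ∧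
      (∀ i, (b' i).IsHomogeneousOfDegree (d i)) ∧ coeffDet b' ≠ 0 ∧
      ∀ i : Fin ℓ, i.val < q → b' i = φ i := by
  induction q with
  | zero => exact ⟨b, hb, hd, hdet, fun i hi => absurd hi (Nat.not_lt_zero _)⟩
  | succ n ih =>
    obtain ⟨b₁, hb₁, hd₁, hdet₁, heq⟩ := ih (by omega) (fun i hi => hφ i (by omega))
      fun k hk => hindep k (by omega)
    obtain ⟨form, hform⟩ := A.exists_form
    obtain ⟨c, hc, hc'⟩ := exists_coeffDet_eq_of_isHomogeneous hform hb₁ hd₁ hsum hdet₁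
    let k : Fin ℓ := ⟨n, by omega⟩
    obtain ⟨hφk, hφd⟩ := hφ k (Nat.lt_succ_self n)
    obtain ⟨g, hg, hgdet⟩ := exists_eq_sum_of_coeffDet_eq hform hb₁ hc hc' hφk
    -- Otherwise `φ k` would be a combination of the earlier `φ i`, already installed in `b₁`.
    obtain ⟨i, hki, hgi⟩ : ∃ i, k ≤ i ∧ g i ≠ 0 := by
      by_contra! h
      refine hindep k (Nat.lt_succ_self n) g (hg.trans ?_)
      rw [← Finset.sum_subset (Finset.subset_univ (Finset.Iio k))]
      · exact Finset.sum_congr rfl fun i hi => by rw [heq i (Fin.lt_def.1 (Finset.mem_Iio.1 hi))]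
      · intro i _ hi
        rw [h i (not_lt.1 fun hlt => hi (Finset.mem_Iio.2 hlt)), zero_smul]
    have hdet₂ : coeffDet (Function.update b₁ i (φ k)) ≠ 0 := hgdet i ▸ mul_ne_zero hdet₁ hgi
    -- The new determinant is `coeffDet b₁ * g i`, nonzero, so its degree is at least the old one,
    -- giving `d i ≤ d k`; monotonicity gives the converse.
    have hdi : d i = d k := by
      refine le_antisymm ?_ (hmono hki)
      have h1 := coeffDet_isHomogeneous (b := Function.update b₁ i (φ k))
        (d := Function.update d i (d k)) fun j => by
          by_cases hji : j = i
          · rwa [hji, Function.update_self, Function.update_self]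
          · rw [Function.update_of_ne hji, Function.update_of_ne hji]
            exact hd₁ j
      rw [Finset.sum_update_of_mem (Finset.mem_univ i), Finset.sdiff_singleton_eq_erase] at h1
      have h2 := ((coeffDet_isHomogeneous hd₁).of_mul_left hdet₁ ((hgdet i).symm ▸ h1)).2
      have h3 := Finset.sum_erase_add _ d (Finset.mem_univ i)
      by_contra hlt
      exact hgi (h2 (by omega))
    -- The swap puts `φ k` at place `k` and moves a displaced `b₁ k` to place `i`. Degrees match
    -- since `d i = d k`, and places below `k` stay fixed since `k ≤ i`.
    have hcases : ∀ j, (j = k ∧ Function.update b₁ i (φ k) (Equiv.swap i k j) = φ k) ∨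
        (j ≠ k ∧ ∃ j', d j' = d j ∧ (j.val < n → j' = j) ∧
          Function.update b₁ i (φ k) (Equiv.swap i k j) = b₁ j') := fun j => by
      by_cases hjk : j = k
      · exact Or.inl ⟨hjk, by rw [hjk, Equiv.swap_apply_right, Function.update_self]⟩
      · refine Or.inr ⟨hjk, ?_⟩
        by_cases hji : j = i
        · refine ⟨k, by rw [hji, hdi], fun hj => absurd hki (not_le.2 (hji ▸ hj)), ?_⟩
          rw [hji, Equiv.swap_apply_left, Function.update_of_ne]
          exact fun h => hjk (hji.trans h.symm)
        · exact ⟨j, rfl, fun _ => rfl, by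
            rw [Equiv.swap_apply_of_ne_of_ne hji hjk, Function.update_of_ne hji]⟩
    refine ⟨fun j => Function.update b₁ i (φ k) (Equiv.swap i k j), fun j => ?_, fun j => ?_,
      coeffDet_comp_perm_ne_zero hdet₂ _, fun j hj => ?_⟩
    · rcases hcases j with ⟨-, h⟩ | ⟨-, j', -, -, h⟩ <;> simp only [h]
      exacts [hφk, hb₁ j']
    · rcases hcases j with ⟨hjk, h⟩ | ⟨-, j', hj', -, h⟩ <;> simp only [h]
      exacts [hjk ▸ hφd, hj' ▸ hd₁ j']
    · rcases hcases j with ⟨hjk, h⟩ | ⟨hjk, j', -, hj', h⟩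
      · exact h.trans (by rw [hjk])
      · have hjn : j.val < n := lt_of_le_of_ne (Nat.le_of_lt_succ hj) fun h => hjk (Fin.ext h)
        exact h.trans (by rw [hj' hjn, heq j hjn])

end Exchange

/-! ### Independent hyperplanes, restriction to `X`, and deletion -/

section MultipleDeletion

variable {K : Type*} [Field K] {ℓ : ℕ}

theorem mem_deletedIndices {q : ℕ} {i : Fin ℓ} :
    i ∈ deletedIndices ℓ q ↔ 1 ≤ i.val ∧ i.val < q := by
  simp [deletedIndices]

theorem card_deletedIndices {q : ℕ} (hq : q ≤ ℓ) : (deletedIndices ℓ q).card = q - 1 := by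
  rw [← Nat.card_Ico 1 q]
  refine Finset.card_nbij Fin.val (fun i hi => ?_) (fun i _ j _ h => Fin.ext h) fun n hn => ?_
  · exact Finset.mem_Ico.2 (mem_deletedIndices.1 hi)
  · have := Finset.mem_Ico.1 hn
    exact ⟨⟨n, by omega⟩, mem_deletedIndices.2 this, rfl⟩

/-- Equality of codimension and number of forms makes the joint evaluation map surjective; preimages
of the unit vectors are dual to the forms. -/
theorem exists_dual_family_of_codim_eq {J : Finset (Fin ℓ)}
    {α : Fin ℓ → Module.Dual K (Fin ℓ → K)}
    (h : codim (⨅ j ∈ J, LinearMap.ker (α j)) = J.card) :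
    ∃ u : Fin ℓ → Fin ℓ → K, ∀ i ∈ J, ∀ k ∈ J, α k (u i) = if k = i then 1 else 0 := by
  classical
  set T : (Fin ℓ → K) →ₗ[K] (J → K) := LinearMap.pi fun j : J => α j
  have hker : LinearMap.ker T = ⨅ j ∈ J, LinearMap.ker (α j) := by
    rw [LinearMap.ker_pi, iInf_subtype]
  have hsurj : LinearMap.range T = ⊤ := by
    refine Submodule.eq_top_of_finrank_eq ?_
    rw [← T.quotKerEquivRange.finrank_eq, hker, Module.finrank_fintype_fun_eq_card,
      Fintype.card_coe]
    exact h
  choose w hw using LinearMap.range_eq_top.1 hsurj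
  refine ⟨fun i => w fun k => if (k : Fin ℓ) = i then 1 else 0, fun i _ k hk => ?_⟩
  exact congrFun (hw fun k => if (k : Fin ℓ) = i then 1 else 0) ⟨k, hk⟩

theorem exists_projection_to_iInf_ker {J : Finset (Fin ℓ)}
    {α : Fin ℓ → Module.Dual K (Fin ℓ → K)} {u : Fin ℓ → Fin ℓ → K}
    (hu : ∀ i ∈ J, ∀ k ∈ J, α k (u i) = if k = i then 1 else 0) :
    ∃ P : (Fin ℓ → K) →ₗ[K] (Fin ℓ → K), (∀ k ∈ J, α k ∘ₗ P = 0) ∧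
      ∀ x ∈ ⨅ j ∈ J, LinearMap.ker (α j), P x = x := by
  refine ⟨LinearMap.id - ∑ i ∈ J, (α i).smulRight (u i), fun k hk => ?_, fun x hx => ?_⟩
  · refine LinearMap.ext fun x => ?_
    simp only [LinearMap.comp_apply, LinearMap.sub_apply, LinearMap.id_apply,
      LinearMap.sum_apply, LinearMap.smulRight_apply, map_sub, map_sum, map_smul, smul_eq_mul,
      LinearMap.zero_apply]
    rw [Finset.sum_eq_single_of_mem k hk fun i hi hik => by
        rw [hu i hi k hk, if_neg hik.symm, mul_zero],
      hu k hk k hk, if_pos rfl, mul_one, sub_self]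
  · simp only [Submodule.mem_iInf, LinearMap.mem_ker] at hx
    rw [LinearMap.sub_apply, LinearMap.sum_apply, Finset.sum_eq_zero, sub_zero, LinearMap.id_apply]
    exact fun i hi => by rw [LinearMap.smulRight_apply, hx i hi, zero_smul]

/-- The Euler derivation and derivations `α_j η_j` satisfy no relation with a coefficient one, if
the `η_j(α_j)` do not vanish after a substitution that kills the `α_j` but some variable not. -/
theorem smul_ne_sum_of_linSubst {J : Finset (Fin ℓ)} {α : Fin ℓ → Module.Dual K (Fin ℓ → K)}
    {η φ : Fin ℓ → PolyDer K ℓ} {i₀ : Fin ℓ} (hφ₀ : φ i₀ = eulerDer K ℓ)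
    (hφ : ∀ j ∈ J, φ j = linearFormPoly (α j) • η j) (hα : ∀ j ∈ J, α j ≠ 0)
    (hdvd : ∀ i ∈ J, ∀ k ∈ J, i ≠ k → linearFormPoly (α k) ∣ η i (linearFormPoly (α k)))
    {R : Type*} [CommRing R] [IsDomain R] {σ : MvPolynomial (Fin ℓ) K →+* R}
    (hσα : ∀ j ∈ J, σ (linearFormPoly (α j)) = 0)
    (hση : ∀ j ∈ J, σ (η j (linearFormPoly (α j))) ≠ 0)
    {m : Fin ℓ} (hm : σ (X m) ≠ 0) {k : Fin ℓ} (hk : k ∈ J) {I : Finset (Fin ℓ)} (hi₀I : i₀ ∈ I)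
    (hI : ∀ i ∈ I, i ≠ i₀ → i ∈ J ∧ i ≠ k) (f : Fin ℓ → MvPolynomial (Fin ℓ) K) :
    φ k ≠ ∑ i ∈ I, f i • φ i := by
  intro h
  -- Apply both sides to `X m`, then `σ`: every term except the Euler one carries some `α_j`, which
  -- `σ` kills.
  have hf : σ (f i₀) = 0 := by
    have h1 := congrArg (fun θ : PolyDer K ℓ => σ (θ (X m))) h
    simp only [sum_smul_apply, hφ k hk, Derivation.smul_apply, smul_eq_mul, map_mul, map_sum,
      hσα k hk, zero_mul] at h1
    rw [Finset.sum_eq_single_of_mem i₀ hi₀I, hφ₀] at h1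
    · simp only [eulerDer, mkDerivation_X] at h1
      exact (mul_eq_zero.1 h1.symm).resolve_right hm
    · intro i hi hne
      have hiJ := (hI i hi hne).1
      rw [hφ i hiJ, Derivation.smul_apply, smul_eq_mul, map_mul, hσα i hiJ, zero_mul, mul_zero]
  -- Evaluated at `α_k`, each term contains `α_k`; the cofactor is `1` for Euler, and still contains
  -- `α_i` for the others.
  have hs : ∀ i, ∃ s, i ∈ I → φ i (linearFormPoly (α k)) = linearFormPoly (α k) * s ∧
      (i ≠ i₀ → σ s = 0) := by
    intro i
    by_cases hi : i ∈ I
    · by_cases hne : i = i₀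
      · exact ⟨1, fun _ => ⟨by rw [hne, hφ₀, eulerDer_linearFormPoly, mul_one],
          fun h => absurd hne h⟩⟩
      · obtain ⟨hiJ, hik⟩ := hI i hi hne
        obtain ⟨s, hs⟩ := hdvd i hiJ k hk hik
        refine ⟨linearFormPoly (α i) * s, fun _ => ⟨?_, fun _ => by
          rw [map_mul, hσα i hiJ, zero_mul]⟩⟩
        rw [hφ i hiJ, Derivation.smul_apply, smul_eq_mul, hs, mul_left_comm]
    · exact ⟨0, fun h => absurd h hi⟩
  choose s hs using hs
  have h2 := congrArg (fun θ : PolyDer K ℓ => θ (linearFormPoly (α k))) h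
  simp only [sum_smul_apply, hφ k hk, Derivation.smul_apply, smul_eq_mul] at h2
  rw [Finset.sum_congr rfl fun i hi => by rw [(hs i hi).1, mul_left_comm], ← Finset.mul_sum] at h2
  have h3 := mul_left_cancel₀ (linearFormPoly_prime (hα k hk)).ne_zero h2
  refine hση k hk ?_
  rw [h3, map_sum]
  refine Finset.sum_eq_zero fun i hi => ?_
  by_cases hne : i = i₀
  · rw [map_mul, hne, hf, zero_mul]
  · rw [map_mul, (hs i hi).2 hne, mul_zero]

namespace HyperplaneArrangement

variable {A : HyperplaneArrangement K ℓ}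

theorem mem_deletion {B : Set (Submodule K (Fin ℓ → K))} {L : Submodule K (Fin ℓ → K)} :
    L ∈ (A.deletion B).hyperplanes ↔ L ∈ A.hyperplanes ∧ L ∉ B := by
  classical
  simp [deletion]

theorem logDer_le_logDer_deletion (B : Set (Submodule K (Fin ℓ → K))) :
    A.logDer ≤ (A.deletion B).logDer :=
  fun _ hθ L hL => hθ L (mem_deletion.1 hL).1

theorem card_deletion_add {J : Finset (Fin ℓ)} {H : Fin ℓ → Submodule K (Fin ℓ → K)}
    (hH : ∀ j ∈ J, H j ∈ A.hyperplanes) (hinj : Set.InjOn H J) :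
    (A.deletion {P | ∃ j ∈ J, P = H j}).hyperplanes.card + J.card = A.hyperplanes.card := by
  classical
  have h : (A.deletion {P | ∃ j ∈ J, P = H j}).hyperplanes = A.hyperplanes \ J.image H := by
    ext L
    simp only [mem_deletion, Set.mem_ofPred_eq, Finset.mem_sdiff, Finset.mem_image,
      eq_comm (a := L)]
  have hsub : J.image H ⊆ A.hyperplanes := Finset.image_subset_iff.2 hH
  rw [h, ← Finset.card_image_of_injOn hinj, Finset.card_sdiff_add_card_eq_card hsub]

/-- The determinant of `b` is the product of the row factors times that of `b'`. -/
theorem coeffDet_ne_zero_of_smul {b b' : Fin ℓ → PolyDer K ℓ}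
    {p : Fin ℓ → MvPolynomial (Fin ℓ) K} (h : ∀ i, b i = p i • b' i) (hb : coeffDet b ≠ 0) :
    coeffDet b' ≠ 0 := by
  intro h0
  have : coeffMatrix b = Matrix.of fun i k => p i * coeffMatrix b' i k := by
    refine Matrix.ext fun i k => ?_
    simp [coeffMatrix, h i]
  rw [coeffDet, this, Matrix.det_mul_column, ← coeffDet, h0, mul_zero] at hb
  exact hb rfl

end HyperplaneArrangement

end MultipleDeletion

/-! ### The multiple deletion theorem -/

open HyperplaneArrangement

/-- Indices are shifted by one: `d ⟨0, _⟩, d ⟨1, _⟩, …` stand for `d_1, d_2, …`, and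
`H`, `α`, `η` are only used at the indices in `deletedIndices ℓ q`, that is `2, …, q`. -/
theorem theorem1p3 {K : Type*} [Field K] {ℓ q : ℕ} (hq : 2 ≤ q) (hqℓ : q ≤ ℓ)
    (A : HyperplaneArrangement K ℓ)
    (d : Fin ℓ → ℕ) (hmono : Monotone d)
    (hd₁ : d ⟨0, by omega⟩ = 1) (hd₂ : 1 < d ⟨1, by omega⟩)
    (hfree : A.IsFreeWithExponents d)
    (H : Fin ℓ → Submodule K (Fin ℓ → K))
    (hH : ∀ j ∈ deletedIndices ℓ q, H j ∈ A.hyperplanes)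
    (α : Fin ℓ → Module.Dual K (Fin ℓ → K))
    (hα : ∀ j ∈ deletedIndices ℓ q, LinearMap.ker (α j) = H j)
    (h₁ : ∀ j ∈ deletedIndices ℓ q,
      (A.hyperplanes.card : ℤ) - ((A.restriction (H j)).card : ℤ) = (d j : ℤ))
    (h₂ : codim (⨅ j ∈ deletedIndices ℓ q, H j) = q - 1)
    (h₃ : ∀ L ∈ (A.deletion {P | ∃ j ∈ deletedIndices ℓ q, P = H j}).hyperplanes,
      ¬ (⨅ j ∈ deletedIndices ℓ q, H j) ≤ L) :
    (A.deletion {P | ∃ j ∈ deletedIndices ℓ q, P = H j}).IsFreeWithExponents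
        (fun i => if i ∈ deletedIndices ℓ q then d i - 1 else d i) ∧
      ∃ (b : Module.Basis (Fin ℓ) (MvPolynomial (Fin ℓ) K) A.logDer)
        (η : Fin ℓ → PolyDer K ℓ),
        (b ⟨0, by omega⟩ : PolyDer K ℓ) = eulerDer K ℓ ∧
        (∀ i ∈ deletedIndices ℓ q,
          (b i : PolyDer K ℓ) = linearFormPoly (α i) • η i ∧
            (η i).IsHomogeneousOfDegree (d i - 1)) ∧
        (∀ i : Fin ℓ, q ≤ i.val → (b i : PolyDer K ℓ).IsHomogeneousOfDegree (d i)) := by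
  classical
  set J := deletedIndices ℓ q with hJ
  have hHα : ⨅ j ∈ J, H j = ⨅ j ∈ J, LinearMap.ker (α j) :=
    iInf_congr fun j => iInf_congr fun hj => (hα j hj).symm
  obtain ⟨u, hu⟩ := exists_dual_family_of_codim_eq (J := J) (α := α) (by
    rw [← hHα, h₂, hJ, card_deletedIndices hqℓ])
  obtain ⟨P, hPα, hPX⟩ := exists_projection_to_iInf_ker hu
  rw [← hHα] at hPX
  have hXle : ∀ j ∈ J, ⨅ j ∈ J, H j ≤ H j := fun j hj => iInf₂_le j hj
  have hnot_le : ∀ L ∈ A.hyperplanes, ⨅ j ∈ J, H j ≤ L → ∃ j ∈ J, L = H j := fun L hL hle => by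
    by_contra hLJ
    exact h₃ L (mem_deletion.2 ⟨hL, hLJ⟩) hle
  have hinj : Set.InjOn H J := fun i hi j hj hij => by
    by_contra hne
    have h1 : u i ∈ H j := by
      rw [← hα j hj, LinearMap.mem_ker, hu i hi j hj, if_neg (Ne.symm hne)]
    rw [← hij, ← hα i hi, LinearMap.mem_ker, hu i hi i hi, if_pos rfl] at h1
    exact one_ne_zero h1
  have hHmem : ∀ j ∈ J, LinearMap.ker (α j) ∈ A.hyperplanes := fun j hj =>
    (hα j hj).symm ▸ hH j hj
  have hα0 : ∀ j ∈ J, α j ≠ 0 := fun j hj =>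
    codim_ker_eq_one_iff.1 (A.codim_eq_one _ (hHmem j hj))
  obtain ⟨b, hbd⟩ := hfree
  obtain ⟨form, hform⟩ := A.exists_form
  obtain ⟨c, hc, hdet⟩ := exists_coeffDet_basis_eq hform b
  have hsum := sum_degrees_eq_card hform hbd hc hdet
  have hcard : ∀ j ∈ J, (A.restriction (H j)).card + d j = A.hyperplanes.card := fun j hj => by
    have := h₁ j hj
    omega
  have hη : ∀ j, ∃ η : PolyDer K ℓ, j ∈ J → η.IsHomogeneousOfDegree (d j - 1) ∧
      linearFormPoly (α j) • η ∈ A.logDer ∧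
      PolyDer.IsHomogeneousOfDegree (linearFormPoly (α j) • η) (d j) ∧
      ¬ linearFormPoly (α j) ∣ η (linearFormPoly (α j)) := fun j => by
    by_cases hj : j ∈ J
    · obtain ⟨η, h⟩ := exists_derivation_of_basis b hbd (hH j hj) (hα j hj) (hcard j hj)
      exact ⟨η, fun _ => h⟩
    · exact ⟨0, fun h => absurd h hj⟩
  choose η hη using hη
  have hlog : ∀ j ∈ J, ∀ β : Module.Dual K (Fin ℓ → K), LinearMap.ker β ∈ A.hyperplanes →
      LinearMap.ker β ≠ H j → linearFormPoly β ∣ η j (linearFormPoly β) :=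
    fun j hj β hβ hne => dvd_of_smul_mem_logDer (hHmem j hj) (hη j hj).2.1 hβ
      (by rwa [hα j hj])
  have hσα : ∀ j ∈ J, linSubst P (linearFormPoly (α j)) = 0 := fun j hj => by
    rw [linSubst_linearFormPoly, hPα j hj, linearFormPoly_zero]
  have hσβ : ∀ β : Module.Dual K (Fin ℓ → K), ¬ ⨅ j ∈ J, H j ≤ LinearMap.ker β →
      linSubst P (linearFormPoly β) ≠ 0 := fun β hβ h0 => hβ fun x hx => by
    rw [linSubst_linearFormPoly, linearFormPoly_eq_zero_iff] at h0
    have := LinearMap.congr_fun h0 x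
    rwa [LinearMap.comp_apply, hPX x hx] at this
  -- A factor of `B` vanishing on `X` defines some `H k`. Its partner `L` contains `H j ∩ H k`,
  -- hence `X`, so it is an `H i` with `i ≠ j, k`; the dual vector `u i` lies in `H j ∩ H k` but not
  -- in `H i`.
  have hση : ∀ j ∈ J, linSubst P (η j (linearFormPoly (α j))) ≠ 0 := fun j hj => by
    refine map_apply_ne_zero (σ := (linSubst P).toRingHom) (hH j hj) (hα j hj) (hcard j hj)
      (hη j hj).1 (hlog j hj) (hη j hj).2.2.2 (hσα j hj) fun β hβ hβj hL => hσβ β fun hle => ?_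
    obtain ⟨L, hLA, hLj, hLβ, hinf⟩ := hL
    obtain ⟨k, hk, hβk⟩ := hnot_le _ hβ hle
    have hjkL : H j ⊓ H k ≤ L := by
      rw [← hβk, ← hinf]
      exact inf_le_right
    obtain ⟨i, hi, rfl⟩ := hnot_le L hLA ((le_inf (hXle j hj) (hXle k hk)).trans hjkL)
    have hij : j ≠ i := fun h => hLj (by rw [h])
    have hik : k ≠ i := fun h => hLβ (by rw [hβk, h])
    have hmem : u i ∈ H i := hjkL ⟨by
      rw [← hα j hj, SetLike.mem_coe, LinearMap.mem_ker, hu i hi j hj, if_neg hij], by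
      rw [← hα k hk, SetLike.mem_coe, LinearMap.mem_ker, hu i hi k hk, if_neg hik]⟩
    rw [← hα i hi, LinearMap.mem_ker, hu i hi i hi, if_pos rfl] at hmem
    exact one_ne_zero hmem
  -- `X` is nonzero because its codimension `q - 1` is less than `ℓ`, so some coordinate survives on
  -- it.
  obtain ⟨m, hm⟩ : ∃ m, linSubst P (X m) ≠ 0 := by
    have hX : ⨅ j ∈ J, H j ≠ ⊥ := fun h => by
      have h1 := (⨅ j ∈ J, H j).finrank_quotient_add_finrank
      rw [Module.finrank_fin_fun, ← codim, h₂, h, finrank_bot] at h1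
      omega
    obtain ⟨x, hx, hx0⟩ := Submodule.exists_mem_ne_zero_of_ne_bot hX
    obtain ⟨m, hm⟩ := Function.ne_iff.1 hx0
    refine ⟨m, ?_⟩
    rw [← linearFormPoly_proj]
    exact hσβ _ fun h => hm (h hx)
  let i₀ : Fin ℓ := ⟨0, by omega⟩
  have hi₀ : i₀ ∉ J := fun h => absurd (mem_deletedIndices.1 h).1 (by simp [i₀])
  set φ : Fin ℓ → PolyDer K ℓ :=
    fun i => if i = i₀ then eulerDer K ℓ else linearFormPoly (α i) • η i with hφ
  have hφ₀ : φ i₀ = eulerDer K ℓ := if_pos rfl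
  have hφJ : ∀ j ∈ J, φ j = linearFormPoly (α j) • η j := fun j hj =>
    if_neg fun h : j = i₀ => hi₀ (h ▸ hj)
  have hJ_of_ne : ∀ i : Fin ℓ, i.val < q → i ≠ i₀ → i ∈ J := fun i hi hne =>
    mem_deletedIndices.2 ⟨Nat.one_le_iff_ne_zero.2 fun h => hne (Fin.ext h), hi⟩
  obtain ⟨b', hb', hd', hdet', hb'φ⟩ := A.exists_coeffDet_ne_zero_extending (φ := φ) hmono
    (fun i => (b i).2) hbd hsum
    (hdet ▸ mul_ne_zero (by simpa using hc) (formProd_ne_zero hform)) hqℓ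
    (fun i hi => by
      by_cases hne : i = i₀
      · rw [hne, hφ₀]
        refine ⟨fun L hL β hβ => ?_, fun β => ?_⟩
        · rw [eulerDer_linearFormPoly]
          exact Ideal.mem_span_singleton_self _
        · rw [eulerDer_linearFormPoly, hd₁]
          exact linearFormPoly_isHomogeneous β
      · have hiJ := hJ_of_ne i hi hne
        rw [hφJ i hiJ]
        exact ⟨(hη i hiJ).2.1, (hη i hiJ).2.2.1⟩)
    (fun k hk f => by
      by_cases hne : k = i₀
      · have hIio : Finset.Iio i₀ = ∅ := Finset.eq_empty_of_forall_notMem fun i hi =>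
          Nat.not_lt_zero _ (Fin.lt_def.1 (Finset.mem_Iio.1 hi))
        rw [hne, hφ₀, hIio, Finset.sum_empty]
        intro h
        have := congrArg (fun θ : PolyDer K ℓ => θ (X i₀)) h
        simp [eulerDer] at this
      · refine smul_ne_sum_of_linSubst (σ := (linSubst P).toRingHom) hφ₀ hφJ hα0
          (fun i hi k hk hik => hlog i hi _ (hHmem k hk) ?_) hσα hση hm (hJ_of_ne k hk hne)
          (Finset.mem_Iio.2 (Nat.pos_of_ne_zero fun h => hne (Fin.ext h))) (fun i hi hi0 => ?_) f
        · rw [hα k hk]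
          exact fun h => hik (hinj hi hk h.symm)
        · rw [Finset.mem_Iio] at hi
          exact ⟨hJ_of_ne i (lt_trans hi hk) hi0, hi.ne⟩)
  have hb'J : ∀ j ∈ J, b' j = linearFormPoly (α j) • η j := fun j hj => by
    rw [hb'φ j (mem_deletedIndices.1 hj).2, hφJ j hj]
  refine ⟨?_, ?_⟩
  · set A' := A.deletion {P | ∃ j ∈ J, P = H j}
    have hform' : ∀ L ∈ A'.hyperplanes, LinearMap.ker (form L) = L := fun L hL =>
      hform L (mem_deletion.1 hL).1
    set b'' : Fin ℓ → PolyDer K ℓ := fun i => if i ∈ J then η i else b' i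
    have hb'' : ∀ i, b'' i ∈ A'.logDer := fun i => by
      by_cases hi : i ∈ J
      · refine (mem_logDer_iff_dvd hform').2 fun L hL => ?_
        obtain ⟨hLA, hLJ⟩ := mem_deletion.1 hL
        simp only [b'', if_pos hi]
        refine hlog i hi _ ?_ ?_ <;> rw [hform L hLA]
        exacts [hLA, fun h => hLJ ⟨i, hi, h⟩]
      · simp only [b'', if_neg hi]
        exact logDer_le_logDer_deletion _ (hb' i)
    have hd'' : ∀ i, (b'' i).IsHomogeneousOfDegree (if i ∈ J then d i - 1 else d i) := fun i => by
      by_cases hi : i ∈ J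
      · simp only [b'', if_pos hi]
        exact (hη i hi).1
      · simp only [b'', if_neg hi]
        exact hd' i
    have hsum'' : ∑ i, (if i ∈ J then d i - 1 else d i) = A'.hyperplanes.card := by
      have h1 := A.card_deletion_add hH hinj
      have h2 : ∑ i, (if i ∈ J then d i - 1 else d i) + J.card = ∑ i, d i := by
        have : J.card = ∑ i, if i ∈ J then 1 else 0 := by simp
        rw [this, ← Finset.sum_add_distrib]
        refine Finset.sum_congr rfl fun i _ => ?_
        split_ifs with hi
        -- Here `1 < d_2 ≤ d i` ensures that `d i - 1` is not truncated.
        · have : d ⟨1, by omega⟩ ≤ d i := hmono (mem_deletedIndices.1 hi).1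
          omega
        · rfl
      exact Nat.add_right_cancel (h2.trans (hsum.trans h1.symm))
    have hdet'' : coeffDet b'' ≠ 0 :=
      coeffDet_ne_zero_of_smul (p := fun i => if i ∈ J then linearFormPoly (α i) else 1)
        (fun i => by
          by_cases hi : i ∈ J
          · simp only [b'', if_pos hi, hb'J i hi]
          · simp only [b'', if_neg hi, one_smul]) hdet'
    obtain ⟨c'', hc'', hcdet''⟩ :=
      exists_coeffDet_eq_of_isHomogeneous hform' hb'' hd'' hsum'' hdet''
    obtain ⟨B, hB⟩ := exists_basis_of_coeffDet_eq hform' hb'' hc'' hcdet''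
    exact ⟨B, fun i => by rw [hB]; exact hd'' i⟩
  · obtain ⟨c', hc', hcdet'⟩ := exists_coeffDet_eq_of_isHomogeneous hform hb' hd' hsum hdet'
    obtain ⟨B, hB⟩ := exists_basis_of_coeffDet_eq hform hb' hc' hcdet'
    refine ⟨B, η, ?_, fun i hi => ⟨?_, (hη i hi).1⟩, fun i _ => hB i ▸ hd' i⟩
    · rw [hB, hb'φ _ (by simp only; omega)]
      exact hφ₀
    · rw [hB, hb'J i hi]
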